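/- Let $\mathbb F_1=\mathbb P(\mathcal O_{\mathbb P^1}\oplus\mathcal O_{\mathbb P^1}(-1))$ be the Hirzebruch surface over $\mathbb C$, let $C_0$ be its negative section ($C_0^2=-1$) and $f$ a fibre of the projection $\mathbb F_1\to\mathbb P^1$. (Line bundles on $\mathbb F_1$ that are numerically equivalent are isomorphic; for a line bundle $L$ we write $L\equiv aC_0+cf$ if $L\cong\mathcal O_{\mathbb F_1}(aC_0+cf)$.) Let $b,k$ be integers with $k\ge b\ge 4$, and let $A$ and $B$ be line bundles on $\mathbb F_1$ with $$A\equiv 2C_0+(2b-k-2)f,\qquad B\equiv C_0+(k-b+2)f .$$ (i) If $b\le k\le 2b-3$, then $H^1(\mathbb F_1,\mathcal E)=0$, i.e. $h^1(\mathcal E)=0$, for every extension $0\to A\to\mathcal E\to B\to 0$. (ii) If $2b-2\le k\le 4b-1$, then $h^1(\mathcal E)=0$ for the general extension: there is a non-empty Zariski-open subset $U$ of the complex vector space $\mathrm{Ext}^1(B,A)$ such that $H^1(\mathbb F_1,\mathcal E)=0$ for every extension $0\to A\to\mathcal E\to B\to 0$ whose class lies in $U$. -/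

import Mathlib

open CategoryTheory AlgebraicGeometry

/-!
The Hirzebruch surface `𝔽₁ = ℙ(𝒪 ⊕ 𝒪(-1))` over `ℙ¹`, as a scheme over `ℂ`.

It has homogeneous coordinates `[t₀ : t₁]` on the base and `[x : y]` on the fibres, taken modulo
`(t₀, t₁, x, y) ∼ (λ t₀, λ t₁, μ x, λ μ y)`, where `t₀, t₁` are not both zero and `x, y` are not
both zero; `x` and `y` are the fibre coordinates coming from the summands `𝒪` and `𝒪(-1)`.
With `z = t₁ / t₀` (base coordinate) and `w = x t₀ / y` (fibre coordinate), the four standard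
affine charts are
`{t₀ y ≠ 0} = Spec ℂ[z, w]`, `{t₁ y ≠ 0} = Spec ℂ[z⁻¹, z w]`,
`{t₀ x ≠ 0} = Spec ℂ[z, w⁻¹]`, `{t₁ x ≠ 0} = Spec ℂ[z⁻¹, z⁻¹ w⁻¹]`.
The negative section is `C₀ = {x = 0}`, and `f = {t₁ = 0}` is a fibre of the projection to `ℙ¹`.
The coordinates `t₀, t₁, x, y` are numbered `0, 1, 2, 3`.
-/

namespace HirzebruchOne

/-- `ord ρ (m, n)` is the order of vanishing of the monomial
`z ^ m * w ^ n = t₀ ^ (n - m) * t₁ ^ m * x ^ n * y ^ (-n)` along the curve on which the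
`ρ`-th homogeneous coordinate vanishes. -/
def ord : Fin 4 → ℤ × ℤ →+ ℤ :=
  ![AddMonoidHom.snd ℤ ℤ - AddMonoidHom.fst ℤ ℤ, AddMonoidHom.fst ℤ ℤ,
    AddMonoidHom.snd ℤ ℤ, -AddMonoidHom.snd ℤ ℤ]

/-- A set `σ` of homogeneous coordinates that are allowed to vanish: not both of `t₀, t₁`, and
not both of `x, y`. It stands for the open subset `U_σ` on which all the coordinates outside `σ`
are nonzero. The four standard charts are the sets with two elements; the others are the
intersections of standard charts, and the empty set stands for the torus. -/
def Cell : Type :=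
  {σ : Finset (Fin 4) // ¬ ({0, 1} ⊆ σ) ∧ ¬ ({2, 3} ⊆ σ)}

instance : PartialOrder Cell := inferInstanceAs (PartialOrder (Subtype _))

/-- The empty cell; its open subset is the torus on which all coordinates are nonzero. -/
def emptyCell : Cell := ⟨∅, by decide⟩

lemma emptyCell_le (σ : Cell) : emptyCell ≤ σ := Finset.empty_subset σ.1

/-- The coordinate ring of `U_σ`: the Laurent polynomials in `z, w` all of whose monomials are
regular along the curves given by the coordinates in `σ`. -/
def coordRing (σ : Cell) : Subalgebra ℂ (AddMonoidAlgebra ℂ (ℤ × ℤ)) where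
  carrier := {f | ∀ m, f.coeff m ≠ 0 → ∀ ρ ∈ σ.1, 0 ≤ ord ρ m}
  mul_mem' {f g} hf hg m hm ρ hρ := by
    classical
    have hm' : m ∈ (f * g).coeff.support := by simpa using hm
    have := AddMonoidAlgebra.support_coeff_mul_subset f g hm'
    obtain ⟨a, ha, b, hb, rfl⟩ := Finset.mem_add.mp this
    rw [map_add]
    exact add_nonneg (hf a (by simpa using ha) ρ hρ) (hg b (by simpa using hb) ρ hρ)
  add_mem' {f g} hf hg m hm ρ hρ := by
    by_cases h : f.coeff m = 0
    · refine hg m (fun h' => hm ?_) ρ hρ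
      simp [h, h']
    · exact hf m h ρ hρ
  algebraMap_mem' c m hm ρ hρ := by
    have : m = 0 := by
      by_contra h
      apply hm
      simp [AddMonoidAlgebra.coe_algebraMap, Ne.symm h]
    simp [this]

lemma coordRing_anti {σ τ : Cell} (h : σ ≤ τ) : coordRing τ ≤ coordRing σ :=
  fun _ hf m hm ρ hρ => hf m hm ρ (h hρ)

/-- Restriction of functions from `U_τ` to `U_σ`, for `σ ⊆ τ`. -/
noncomputable def restr {σ τ : Cell} (h : σ ≤ τ) : coordRing τ →+* coordRing σ :=
  (Subalgebra.inclusion (coordRing_anti h)).toRingHom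

lemma exists_exponent_aux : ∀ σ τ : Finset (Fin 4), σ ⊆ τ → ¬ ({0, 1} ⊆ τ) → ¬ ({2, 3} ⊆ τ) →
    ∃ i : Fin 5, ∃ j : Fin 5, ∀ ρ : Fin 4, ρ ∈ τ → (0 ≤ ord ρ ((i : ℤ) - 2, (j : ℤ) - 2) ∧
      (ord ρ ((i : ℤ) - 2, (j : ℤ) - 2) = 0 ↔ ρ ∈ σ)) := by
  set_option synthInstance.maxSize 1000 in
  set_option synthInstance.maxHeartbeats 200000 in
  decide

lemma exists_exponent {σ τ : Cell} (h : σ ≤ τ) :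
    ∃ m : ℤ × ℤ, ∀ ρ ∈ τ.1, 0 ≤ ord ρ m ∧ (ord ρ m = 0 ↔ ρ ∈ σ.1) := by
  obtain ⟨i, j, hij⟩ := exists_exponent_aux σ.1 τ.1 h τ.2.1 τ.2.2
  exact ⟨_, hij⟩

/-- The monomial `z ^ m.1 * w ^ m.2`. -/
noncomputable def monomial (m : ℤ × ℤ) : AddMonoidAlgebra ℂ (ℤ × ℤ) := AddMonoidAlgebra.single m 1

lemma monomial_mem {σ : Cell} {m : ℤ × ℤ} (h : ∀ ρ ∈ σ.1, 0 ≤ ord ρ m) :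
    monomial m ∈ coordRing σ := by
  intro a ha ρ hρ
  have : a = m := by
    by_contra h'
    exact ha (by simp [monomial, Ne.symm h'])
  exact this ▸ h ρ hρ

lemma monomial_mul (m n : ℤ × ℤ) : monomial m * monomial n = monomial (m + n) := by
  simp [monomial, AddMonoidAlgebra.single_mul_single]

lemma monomial_pow (m : ℤ × ℤ) (n : ℕ) : monomial m ^ n = monomial (n • m) := by
  simp [monomial, AddMonoidAlgebra.single_pow]

lemma monomial_zero : monomial 0 = 1 := rfl

lemma isLocalization {σ τ : Cell} (h : σ ≤ τ) {m : ℤ × ℤ}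
    (hm : ∀ ρ ∈ τ.1, 0 ≤ ord ρ m ∧ (ord ρ m = 0 ↔ ρ ∈ σ.1)) :
    let := (restr h).toAlgebra
    IsLocalization.Away (⟨monomial m, monomial_mem fun ρ hρ => (hm ρ hρ).1⟩ : coordRing τ)
      (coordRing σ) := by
  let := (restr h).toAlgebra
  have hal (x : coordRing τ) : ((algebraMap (coordRing τ) (coordRing σ) x : coordRing σ) :
    AddMonoidAlgebra ℂ (ℤ × ℤ)) = x := rfl
  refine (_root_.isLocalization_iff _ _).mpr ⟨?_, ?_, ?_⟩
  · rintro ⟨_, n, rfl⟩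
    rw [map_pow]
    refine IsUnit.pow _ ?_
    refine IsUnit.of_mul_eq_one ⟨monomial (-m), monomial_mem fun ρ hρ => ?_⟩ ?_
    · rw [map_neg, ((hm ρ (h hρ)).2).mpr hρ, neg_zero]
    · apply Subtype.ext
      simp only [MulMemClass.coe_mul, hal]
      rw [monomial_mul, add_neg_cancel, monomial_zero]; rfl
  · rintro ⟨f, hf⟩
    let N : ℕ := ∑ a ∈ f.coeff.support, ∑ ρ : Fin 4, (ord ρ a).natAbs
    have hN (a) (ha : a ∈ f.coeff.support) (ρ : Fin 4) : -(N : ℤ) ≤ ord ρ a := by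
      have h1 : (ord ρ a).natAbs ≤ ∑ ρ : Fin 4, (ord ρ a).natAbs :=
        Finset.single_le_sum (f := fun ρ => (ord ρ a).natAbs) (fun _ _ => Nat.zero_le _)
          (Finset.mem_univ ρ)
      have h2 : ∑ ρ : Fin 4, (ord ρ a).natAbs ≤ N :=
        Finset.single_le_sum (f := fun a => ∑ ρ : Fin 4, (ord ρ a).natAbs)
          (fun _ _ => Nat.zero_le _) ha
      omega
    refine ⟨⟨⟨f * monomial m ^ N, ?_⟩, ⟨_, N, rfl⟩⟩, ?_⟩
    · classical
      rw [monomial_pow]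
      intro a ha ρ hρ
      have ha' : a ∈ (f * monomial (N • m)).coeff.support := by simpa using ha
      obtain ⟨b, hb, c, hc, rfl⟩ :=
        Finset.mem_add.mp (AddMonoidAlgebra.support_coeff_mul_subset _ _ ha')
      have hc' : c = N • m := by
        by_contra h'
        exact h' (by simpa [monomial] using hc)
      subst hc'
      rw [map_add, map_nsmul]
      by_cases hρσ : ρ ∈ σ.1
      · rw [((hm ρ hρ).2).mpr hρσ, smul_zero, add_zero]
        exact hf b (by simpa using hb) ρ hρσ
      · have h1 : 1 ≤ ord ρ m := by
          have := (hm ρ hρ).1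
          have h2 : ord ρ m ≠ 0 := fun h => hρσ ((hm ρ hρ).2.mp h)
          omega
        have h2 := hN b hb ρ
        have h3 : (N : ℤ) ≤ N • ord ρ m := by
          rw [nsmul_eq_mul]; nlinarith [Int.natCast_nonneg N]
        linarith
    · apply Subtype.ext
      simp [hal]
  · intro x y hxy
    have hv := congrArg Subtype.val hxy
    simp only [hal] at hv
    exact ⟨1, by rw [Subtype.ext hv]⟩

/-- The affine pieces `U_σ = Spec (coordRing σ)` with their inclusions `U_σ ⊆ U_τ` for `σ ⊆ τ`. -/
noncomputable def diagram : Cell ⥤ Scheme.{0} where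
  obj σ := Spec (.of (coordRing σ))
  map h := Spec.map (CommRingCat.ofHom (restr (leOfHom h)))
  map_id σ := by
    rw [← Spec.map_id]; rfl
  map_comp f g := by
    rw [← Spec.map_comp]; rfl

instance {σ τ : Cell} (f : σ ⟶ τ) : IsOpenImmersion (diagram.map f) := by
  obtain ⟨m, hm⟩ := exists_exponent (leOfHom f)
  let := (restr (leOfHom f)).toAlgebra
  have := isLocalization (leOfHom f) hm
  exact IsOpenImmersion.of_isLocalization (S := coordRing σ)
    (⟨monomial m, monomial_mem fun ρ hρ => (hm ρ hρ).1⟩ : coordRing τ)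

lemma range_map {σ τ : Cell} (f : σ ⟶ τ) {m : ℤ × ℤ}
    (hm : ∀ ρ ∈ τ.1, 0 ≤ ord ρ m ∧ (ord ρ m = 0 ↔ ρ ∈ σ.1)) :
    Set.range (diagram.map f) = (PrimeSpectrum.basicOpen
      (⟨monomial m, monomial_mem fun ρ hρ => (hm ρ hρ).1⟩ : coordRing τ) :
        Set (PrimeSpectrum (coordRing τ))) := by
  let := (restr (leOfHom f)).toAlgebra
  have := isLocalization (leOfHom f) hm
  exact PrimeSpectrum.localization_away_comap_range (coordRing σ)
    (⟨monomial m, monomial_mem fun ρ hρ => (hm ρ hρ).1⟩ : coordRing τ)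

instance : (diagram ⋙ Scheme.forget).IsLocallyDirected where
  cond {σ τ κ} f g x y hxy := by
    let ν : Cell := ⟨σ.1 ∩ τ.1, fun h => σ.2.1 (h.trans Finset.inter_subset_left),
      fun h => σ.2.2 (h.trans Finset.inter_subset_left)⟩
    have hσ : ν ≤ σ := Finset.inter_subset_left
    have hτ : ν ≤ τ := Finset.inter_subset_right
    obtain ⟨m, hm⟩ := exists_exponent (leOfHom f)
    obtain ⟨n, hn⟩ := exists_exponent (leOfHom g)
    have hmn : ∀ ρ ∈ κ.1, 0 ≤ ord ρ (m + n) ∧ (ord ρ (m + n) = 0 ↔ ρ ∈ ν.1) := by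
      intro ρ hρ
      have h1 := hm ρ hρ
      have h2 := hn ρ hρ
      have h3 : ρ ∈ ν.1 ↔ ρ ∈ σ.1 ∧ ρ ∈ τ.1 := Finset.mem_inter
      rw [h3, ← h1.2, ← h2.2, map_add]
      omega
    let p : PrimeSpectrum (coordRing κ) := diagram.map f x
    have hp1 : p ∈ Set.range (diagram.map f) := ⟨x, rfl⟩
    have hp2 : p ∈ Set.range (diagram.map g) := ⟨y, hxy.symm⟩
    have hp : p ∈ Set.range (diagram.map (homOfLE (hσ.trans (leOfHom f)))) := by
      rw [range_map _ hm] at hp1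
      rw [range_map _ hn] at hp2
      rw [range_map _ hmn]
      intro h
      have : (⟨monomial (m + n), monomial_mem fun ρ hρ => (hmn ρ hρ).1⟩ : coordRing κ) =
        ⟨monomial m, monomial_mem fun ρ hρ => (hm ρ hρ).1⟩ *
        ⟨monomial n, monomial_mem fun ρ hρ => (hn ρ hρ).1⟩ :=
          Subtype.ext (monomial_mul m n).symm
      rw [this] at h
      exact (p.2.mem_or_mem h).elim hp1 hp2
    obtain ⟨z, hz⟩ := hp
    refine ⟨ν, homOfLE hσ, homOfLE hτ, z, ?_, ?_⟩
    · apply (diagram.map f).isOpenEmbedding.injective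
      change (diagram.map f) (diagram.map (homOfLE hσ) z) = _
      rw [← Scheme.Hom.comp_apply, ← Functor.map_comp]
      exact hz
    · apply (diagram.map g).isOpenEmbedding.injective
      change (diagram.map g) (diagram.map (homOfLE hτ) z) = _
      rw [← Scheme.Hom.comp_apply, ← Functor.map_comp]
      exact hz.trans hxy

/-- The Hirzebruch surface `𝔽₁`, obtained by gluing the four standard affine charts. -/
noncomputable def F1 : Scheme.{0} := Limits.colimit diagram

/-- The open immersion `U_σ → 𝔽₁`. -/
noncomputable def incl (σ : Cell) : Spec (.of (coordRing σ)) ⟶ F1 := Limits.colimit.ι diagram σ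

instance (σ : Cell) : IsOpenImmersion (incl σ) :=
  inferInstanceAs (IsOpenImmersion (Limits.colimit.ι diagram σ))

/-- `U_σ` as an open subset of `𝔽₁`. -/
noncomputable def chart (σ : Cell) : F1.Opens := incl σ ''ᵁ ⊤

lemma chart_mono {σ τ : Cell} (h : σ ≤ τ) : chart σ ≤ chart τ := by
  rintro _ ⟨x, -, rfl⟩
  refine ⟨diagram.map (homOfLE h) x, trivial, ?_⟩
  have : diagram.map (homOfLE h) ≫ incl τ = incl σ := Limits.colimit.w diagram (homOfLE h)
  rw [← this]; rfl

/-- The function on the open subset `U_σ` of `𝔽₁` given by an element of `coordRing σ`. -/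
noncomputable def chartFun (σ : Cell) : coordRing σ →+* Γ(F1, chart σ) :=
  ((Scheme.ΓSpecIso (.of (coordRing σ))).inv ≫ ((incl σ).appIso ⊤).inv).hom

/-- The monomial `z ^ m.1 * w ^ m.2` as a function on the torus in `𝔽₁`. -/
noncomputable def torusMonomial (m : ℤ × ℤ) : Γ(F1, chart emptyCell) :=
  chartFun emptyCell ⟨monomial m, monomial_mem fun _ h => absurd h (Finset.notMem_empty _)⟩

/-- The structure morphism `𝔽₁ → Spec ℂ`. -/
noncomputable def structureMap : F1 ⟶ Spec (.of ℂ) :=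
  Limits.colimit.desc diagram
    { pt := Spec (.of ℂ)
      ι :=
        { app := fun σ => Spec.map (CommRingCat.ofHom (algebraMap ℂ (coordRing σ)))
          naturality := fun σ τ f => by
            change Spec.map _ ≫ Spec.map _ = Spec.map _ ≫ 𝟙 _
            rw [← Spec.map_comp, Category.comp_id]; rfl } }

end HirzebruchOne

namespace ModuleSheaf

variable {X : Scheme.{0}}

/-- The restriction to `U` of a global function `r`. -/
def resTop (r : Γ(X, ⊤)) (U : X.Opens) : Γ(X, U) := X.presheaf.map (homOfLE le_top).op r

lemma map_resTop (r : Γ(X, ⊤)) {U V : X.Opens} (i : U ⟶ V) :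
    X.presheaf.map i.op (resTop r V) = resTop r U := by
  simp only [resTop]
  rw [← CommRingCat.comp_apply, ← Functor.map_comp]
  rfl

/-- Multiplication by a global function `r` on a sheaf of modules. -/
noncomputable def smulEnd (r : Γ(X, ⊤)) (M : X.Modules) : M ⟶ M :=
  ⟨PresheafOfModules.homMk (M₁ := M.val) (M₂ := M.val)
    { app := fun U => M.smul (resTop r U.unop)
      naturality := fun U V f => by
        have := M.map_comp_smul f.unop (resTop r U.unop)
        rw [map_resTop] at this
        exact this.symm }
    (fun U s m => by
        change resTop r U.unop • ((show Γ(X, U.unop) from s) • (show Γ(M, U.unop) from m)) =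
          (show Γ(X, U.unop) from s) • (resTop r U.unop • (show Γ(M, U.unop) from m))
        rw [smul_smul, smul_smul, mul_comm])⟩

lemma smulEnd_app (r : Γ(X, ⊤)) (M : X.Modules) (U : X.Opens) (x : Γ(M, U)) :
    (smulEnd r M).app U x = resTop r U • x := rfl

/-- Global functions act on every sheaf of modules, compatibly with all morphisms. -/
noncomputable def centerHom : Γ(X, ⊤) →+* CatCenter X.Modules where
  toFun r :=
    { app := smulEnd r
      naturality := fun M N φ => by
        ext U x
        change (smulEnd r N).app U (φ.app U x) = φ.app U ((smulEnd r M).app U x)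
        rw [smulEnd_app, smulEnd_app, Scheme.Modules.Hom.app_smul] }
  map_one' := by
    ext M U x
    change resTop 1 U • x = x
    simp [resTop]
  map_mul' r s := by
    ext M U x
    change resTop (r * s) U • x = resTop r U • resTop s U • x
    simp [resTop, mul_smul]
  map_zero' := by
    ext M U x
    change resTop 0 U • x = 0
    simp [resTop]
  map_add' r s := by
    ext M U x
    change resTop (r + s) U • x = resTop r U • x + resTop s U • x
    simp [resTop, add_smul]

/-- The section `e` of `M` over `U` is a free generator there: multiplication by `e` is an
isomorphism from the structure sheaf of `U` to the restriction of `M` to `U`. -/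
def IsFreeGenerator (M : X.Modules) (U : X.Opens) (e : Γ(M, U)) : Prop :=
  ∀ (V : X.Opens) (h : V ≤ U),
    Function.Bijective fun r : Γ(X, V) => r • M.presheaf.map (homOfLE h).op e

/-- The `n`-th cohomology group of (the abelian sheaf underlying) a sheaf of modules. -/
noncomputable abbrev H (M : X.Modules) (n : ℕ) : Type :=
  Sheaf.H ((SheafOfModules.toSheaf X.ringCatSheaf).obj M) n

end ModuleSheaf

namespace HirzebruchOne

/-- The category of sheaves of modules on `𝔽₁` is `ℂ`-linear, through the structure morphism. -/
noncomputable instance : Linear ℂ F1.Modules :=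
  Linear.ofRingMorphism (ModuleSheaf.centerHom.comp
    ((Scheme.ΓSpecIso (.of ℂ)).inv ≫ structureMap.appTop).hom)

instance : HasExt.{1} F1.Modules := HasExt.standard _

/-- `L` is isomorphic to the line bundle `𝒪(D)` of the divisor `D = ∑ ρ, d ρ • {ρ-th coordinate = 0}`:
it is an invertible sheaf with a rational section `s` (the one that corresponds to the rational
function `1`) whose divisor is `D`. That is, on each `U_σ` there are a free generator `e` of `L`
and a local equation of `D`, a monomial with order `d ρ` along each of the curves that meet
`U_σ`, such that `s` is the local equation times `e`. -/
def IsLineBundleOfDivisor (d : Fin 4 → ℤ) (L : F1.Modules) : Prop :=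
  ∃ s : Γ(L, chart emptyCell), ∀ σ : Cell, ∃ (e : Γ(L, chart σ)) (m : ℤ × ℤ),
    ModuleSheaf.IsFreeGenerator L (chart σ) e ∧ (∀ ρ ∈ σ.1, ord ρ m = d ρ) ∧
      s = torusMonomial m • L.presheaf.map (homOfLE (chart_mono (emptyCell_le σ))).op e

/-- `L` is a line bundle in the class `a C₀ + b f`, where `C₀ = {x = 0}` and `f = {t₁ = 0}`:
`L ≅ 𝒪(a C₀ + b f)`. On `𝔽₁` numerically equivalent line bundles are isomorphic and `C₀, f` form
a basis of `Pic = Num`, so that this says that `L` is a line bundle with `L ≡ a C₀ + b f`. -/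
def IsLineBundleOfClass (a b : ℤ) (L : F1.Modules) : Prop :=
  IsLineBundleOfDivisor ![0, b, a, 0] L

end HirzebruchOne

section Zariski

variable {V : Type*} [AddCommGroup V] [Module ℂ V]

variable (V) in
/-- The polynomial functions on a complex vector space: the algebra of functions generated by
the linear forms. -/
def polyFunctions : Subalgebra ℂ (V → ℂ) :=
  Algebra.adjoin ℂ (Set.range fun φ : Module.Dual ℂ V => (φ : V → ℂ))

/-- Zariski-open subsets of a complex vector space: the sets of points at which some member of a
given family of polynomial functions does not vanish. -/
def IsZariskiOpen (U : Set V) : Prop :=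
  ∃ P : Set (V → ℂ), P ⊆ polyFunctions V ∧ U = {v | ∃ p ∈ P, p v ≠ 0}

end Zariski

open TopologicalSpace Opposite

/-!
Let `V₀ = {t₀ ≠ 0}` and `V₁ = {t₁ ≠ 0}` be the preimages in `𝔽₁` of the standard open sets of `ℙ¹`.
Sections of the line bundle of a torus invariant divisor over a union of charts are the Laurent
polynomials whose poles along the invariant curves meeting that union are bounded by the divisor
(`SectionsBounded`), so that Čech cohomology becomes a matter of counting monomials.

Vanishing of `H¹` is handled through the property `LiftsOver F V`: sections over `V` lift along
epimorphisms of abelian sheaves whose kernel is `F` on `V`. It holds for free modules on affine open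
sets (`liftsOver_of_isAffineOpen`), passes to unions of two open sets if sections over the
intersection are differences of sections (`LiftsOver.sup`), and over the whole space it gives
`H¹ = 0` (`LiftsOver.subsingleton_H`). The monomial description of sections shows that it holds for
`A` and `B` on `V₀` and `V₁`, for `B` on `𝔽₁`, and for `A` on `𝔽₁` if `k ≤ 2 b - 3`. In that range
the long exact cohomology sequence gives the vanishing for every extension.

For `k ≥ 2 b - 2` the space `H¹(A)` need not vanish, and the question is whether the connecting map
`H⁰(B) ⟶ H¹(A)` is onto. It is studied in `Ext¹(𝒪, A)`: the Čech sequence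
`0 ⟶ A ⟶ A|V₀ ⊕ A|V₁ ⟶ A|V₀∩V₁ ⟶ 0` of sheaves of modules (`shortExact_cech`) has a connecting map
`∂`, the products of sections of `B` with the class of an extension lie in the image of `∂`
(`exists_cech_representative`), and `H¹(E) = 0` as soon as they fill that image
(`subsingleton_H_of_connecting_surjective`). They fill it for the extension class `∂(g)`, where
`g = z ^ (k - b + 3) + z ^ (b + 1) + z ^ (k - 2 b + 2) w⁻¹` is regarded as a morphism from `B` to
`A|V₀∩V₁`. This is the combinatorial heart of the proof (`boundedPoles_inf_le`), and it uses
`k ≤ 4 b - 1`. As `H⁰(B)` is finite-dimensional, filling the image is implied by the nonvanishing of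
a determinant which is a polynomial function of the class, and which is `1` at `∂(g)`
(`exists_isZariskiOpen_range_le`).
-/

/-! ### Lifting sections along epimorphisms of abelian sheaves -/

namespace SheafLifting

universe u

variable {X : TopCat.{u}}

lemma map_map (F : TopCat.Presheaf AddCommGrpCat.{u} X) {U V W : Opens X} (h : V ≤ U) (h' : W ≤ V)
    (s : F.obj (op U)) :
    F.map (homOfLE h').op (F.map (homOfLE h).op s) = F.map (homOfLE (h'.trans h)).op s := by
  rw [← ConcreteCategory.comp_apply, ← Functor.map_comp]
  rfl

lemma map_self (F : TopCat.Presheaf AddCommGrpCat.{u} X) {U : Opens X} (h : U ≤ U)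
    (s : F.obj (op U)) : F.map (homOfLE h).op s = s := by
  have : (homOfLE h).op = 𝟙 (op U) := rfl
  rw [this, F.map_id]
  rfl

lemma map_naturality {F G : TopCat.Presheaf AddCommGrpCat.{u} X} (φ : F ⟶ G) {U V : Opens X}
    (h : V ≤ U) (s : F.obj (op U)) :
    φ.app (op V) (F.map (homOfLE h).op s) = G.map (homOfLE h).op (φ.app (op U) s) :=
  ConcreteCategory.congr_hom (φ.naturality (homOfLE h).op) s

lemma eq_of_forall_nhds (F : Sheaf (Opens.grothendieckTopology X) AddCommGrpCat.{u}) {V : Opens X}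
    {s t : F.obj.obj (op V)}
    (h : ∀ x ∈ V, ∃ (W : Opens X) (hW : W ≤ V), x ∈ W ∧
      F.obj.map (homOfLE hW).op s = F.obj.map (homOfLE hW).op t) : s = t := by
  choose W hW hx hst using h
  refine TopCat.Sheaf.eq_of_locally_eq' (F : TopCat.Sheaf AddCommGrpCat X)
    (fun x : V => W x.1 x.2) V (fun x => homOfLE (hW _ _)) ?_ s t fun x => hst _ _
  intro x hx'
  exact Opens.mem_iSup.mpr ⟨⟨x, hx'⟩, hx x hx'⟩

lemma exists_glue (F : Sheaf (Opens.grothendieckTopology X) AddCommGrpCat.{u})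
    {V V₁ V₂ : Opens X} (h₁ : V₁ ≤ V)
    (h₂ : V₂ ≤ V) (hV : V ≤ V₁ ⊔ V₂) (s₁ : F.obj.obj (op V₁)) (s₂ : F.obj.obj (op V₂))
    (h : F.obj.map (homOfLE inf_le_left).op s₁ =
      F.obj.map (homOfLE (inf_le_right : V₁ ⊓ V₂ ≤ V₂)).op s₂) :
    ∃ s : F.obj.obj (op V), F.obj.map (homOfLE h₁).op s = s₁ ∧
      F.obj.map (homOfLE h₂).op s = s₂ := by
  let Vf : Bool → Opens X := fun i => cond i V₁ V₂
  let sf : ∀ i, F.obj.obj (op (Vf i)) := fun i => match i with | true => s₁ | false => s₂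
  have hsf : TopCat.Presheaf.IsCompatible F.obj Vf sf := by
    rintro (_ | _) (_ | _)
    · rfl
    · have := congrArg (F.obj.map (homOfLE (le_of_eq (inf_comm V₂ V₁))).op) h
      rw [map_map, map_map] at this
      exact this.symm
    · exact h
    · rfl
  obtain ⟨s, hs, -⟩ := TopCat.Sheaf.existsUnique_gluing' (F : TopCat.Sheaf AddCommGrpCat X) Vf V
    (fun i => homOfLE (by cases i; exacts [h₂, h₁]))
    (fun x hx => by
      rcases hV hx with hx | hx
      · exact Opens.mem_iSup.mpr ⟨true, hx⟩
      · exact Opens.mem_iSup.mpr ⟨false, hx⟩) sf hsf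
  exact ⟨s, hs true, hs false⟩

variable {S : ShortComplex (Sheaf (Opens.grothendieckTopology X) AddCommGrpCat.{u})}

lemma exists_local_lift (hS : S.ShortExact) {V : Opens X} (q : S.X₃.obj.obj (op V)) {x : X}
    (hx : x ∈ V) : ∃ (W : Opens X) (hW : W ≤ V), x ∈ W ∧ ∃ g : S.X₂.obj.obj (op W),
      S.g.hom.app (op W) g = S.X₃.obj.map (homOfLE hW).op q := by
  have := (TopCat.Sheaf.isLocallySurjective_iff_epi S.g).mpr hS.epi_g
  obtain ⟨W, Wle, ⟨t, ht⟩, hW⟩ :=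
    (TopCat.Presheaf.isLocallySurjective_iff S.g.hom).mp this V q x hx
  exact ⟨W, Wle, hW, t, ht⟩

lemma exists_preimage (hS : S.ShortExact) {V : Opens X} (t : S.X₂.obj.obj (op V))
    (ht : S.g.hom.app (op V) t = 0) : ∃ a, S.f.hom.app (op V) a = t :=
  TopCat.Sheaf.sections_exact_of_left_exact hS.1 hS.2 t ht

lemma f_comp_g_apply
    (S : ShortComplex (Sheaf (Opens.grothendieckTopology X) AddCommGrpCat.{u})) {V : Opens X}
    (a : S.X₁.obj.obj (op V)) : S.g.hom.app (op V) (S.f.hom.app (op V) a) = 0 := by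
  have : (S.f ≫ S.g).hom.app (op V) a = 0 := by rw [S.zero]; rfl
  exact this

lemma injective_of_mono {F G : Sheaf (Opens.grothendieckTopology X) AddCommGrpCat.{u}}
    (f : F ⟶ G) [Mono f] (V : Opens X) : Function.Injective (f.hom.app (op V)) := by
  have h1 : Mono f.hom := inferInstanceAs (Mono ((sheafToPresheaf _ _).map f))
  have h2 : Mono (f.hom.app (op V)) := inferInstance
  exact (AddCommGrpCat.mono_iff_injective _).mp h2

/-- Two local lifts along an epimorphism of sheaves can be corrected so as to glue, provided that
every section of the kernel over the overlap is a difference of sections over the two pieces. -/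
lemma exists_lift_sup (hS : S.ShortExact) {V V₁ V₂ : Opens X} (h₁ : V₁ ≤ V) (h₂ : V₂ ≤ V)
    (hV : V ≤ V₁ ⊔ V₂) (q : S.X₃.obj.obj (op V))
    (g₁ : S.X₂.obj.obj (op V₁)) (hg₁ : S.g.hom.app _ g₁ = S.X₃.obj.map (homOfLE h₁).op q)
    (g₂ : S.X₂.obj.obj (op V₂)) (hg₂ : S.g.hom.app _ g₂ = S.X₃.obj.map (homOfLE h₂).op q)
    (hsum : ∀ a : S.X₁.obj.obj (op (V₁ ⊓ V₂)), ∃ a₁ a₂,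
      a = S.X₁.obj.map (homOfLE inf_le_left).op a₁ - S.X₁.obj.map (homOfLE inf_le_right).op a₂) :
    ∃ g, S.g.hom.app (op V) g = q := by
  obtain ⟨a, ha⟩ := exists_preimage hS (S.X₂.obj.map (homOfLE inf_le_left).op g₁ -
    S.X₂.obj.map (homOfLE (inf_le_right : V₁ ⊓ V₂ ≤ V₂)).op g₂) (by
      rw [map_sub, map_naturality, map_naturality, hg₁, hg₂, map_map, map_map, sub_self])
  obtain ⟨a₁, a₂, rfl⟩ := hsum a
  rw [map_sub, map_naturality, map_naturality] at ha
  obtain ⟨g, hgl, hgr⟩ := exists_glue S.X₂ h₁ h₂ hV (g₁ - S.f.hom.app _ a₁)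
    (g₂ - S.f.hom.app _ a₂) (by
      rw [map_sub, map_sub]
      rw [sub_eq_sub_iff_sub_eq_sub]
      exact ha.symm)
  refine ⟨g, eq_of_forall_nhds _ fun x hx => ?_⟩
  rcases hV hx with hx | hx
  · refine ⟨V₁, h₁, hx, ?_⟩
    rw [← map_naturality, hgl, map_sub, f_comp_g_apply, sub_zero, hg₁]
  · refine ⟨V₂, h₂, hx, ?_⟩
    rw [← map_naturality, hgr, map_sub, f_comp_g_apply, sub_zero, hg₂]

/-- The vanishing of the first cohomology of `F` on `V`, in terms of lifts of sections: whenever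
`F|_V` is the kernel of an epimorphism of sheaves, sections over `V` lift along that epimorphism.
The kernel is identified with `F` over `V` only, by a morphism `u`. -/
def LiftsOver (F : Sheaf (Opens.grothendieckTopology X) AddCommGrpCat.{u}) (V : Opens X) : Prop :=
  ∀ (S : ShortComplex (Sheaf (Opens.grothendieckTopology X) AddCommGrpCat.{u})), S.ShortExact →
    ∀ u : F ⟶ S.X₁, (∀ W ≤ V, Function.Bijective (u.hom.app (op W))) →
      Function.Surjective (S.g.hom.app (op V))

lemma LiftsOver.surjective {V : Opens X} (h : LiftsOver S.X₁ V) (hS : S.ShortExact) :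
    Function.Surjective (S.g.hom.app (op V)) :=
  h S hS (𝟙 _) fun _ _ => Function.bijective_id

lemma LiftsOver.of_bijective {F G : Sheaf (Opens.grothendieckTopology X) AddCommGrpCat.{u}}
    {V : Opens X} (η : F ⟶ G)
    (hη : ∀ W ≤ V, Function.Bijective (η.hom.app (op W))) (h : LiftsOver F V) : LiftsOver G V :=
  fun S hS u hu => h S hS (η ≫ u) fun W hW => (hu W hW).comp (hη W hW)

/-- The Mayer–Vietoris argument for `LiftsOver`. -/
lemma LiftsOver.sup {F : Sheaf (Opens.grothendieckTopology X) AddCommGrpCat.{u}} {V₁ V₂ : Opens X}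
    (h₁ : LiftsOver F V₁) (h₂ : LiftsOver F V₂)
    (hsum : ∀ a : F.obj.obj (op (V₁ ⊓ V₂)), ∃ a₁ a₂,
      a = F.obj.map (homOfLE inf_le_left).op a₁ - F.obj.map (homOfLE inf_le_right).op a₂) :
    LiftsOver F (V₁ ⊔ V₂) := by
  intro S hS u hu q
  obtain ⟨g₁, hg₁⟩ := h₁ S hS u (fun W hW => hu W (hW.trans le_sup_left))
    (S.X₃.obj.map (homOfLE le_sup_left).op q)
  obtain ⟨g₂, hg₂⟩ := h₂ S hS u (fun W hW => hu W (hW.trans le_sup_right))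
    (S.X₃.obj.map (homOfLE le_sup_right).op q)
  refine exists_lift_sup hS le_sup_left le_sup_right le_rfl q g₁ hg₁ g₂ hg₂ fun a => ?_
  obtain ⟨b, rfl⟩ := (hu _ (inf_le_left.trans le_sup_left)).2 a
  obtain ⟨b₁, b₂, rfl⟩ := hsum b
  refine ⟨u.hom.app _ b₁, u.hom.app _ b₂, ?_⟩
  rw [map_sub, map_naturality, map_naturality]

/-- If `F` is the direct image of its restriction to `V`, then lifts over `V` extend uniquely. -/
lemma LiftsOver.top {F : Sheaf (Opens.grothendieckTopology X) AddCommGrpCat.{u}} {V : Opens X}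
    (h : LiftsOver F V) (hF : ∀ W : Opens X, Function.Bijective
      (F.obj.map (homOfLE (inf_le_right : V ⊓ W ≤ W)).op)) : LiftsOver F ⊤ := by
  intro S hS u hu q
  obtain ⟨h₀, hh₀⟩ := h S hS u (fun W hW => hu W le_top) (S.X₃.obj.map (homOfLE le_top).op q)
  have hinj : ∀ (W : Opens X) (g g' : S.X₂.obj.obj (op W)),
      S.g.hom.app _ g = S.g.hom.app _ g' →
      S.X₂.obj.map (homOfLE (inf_le_right : V ⊓ W ≤ W)).op g =
        S.X₂.obj.map (homOfLE inf_le_right).op g' →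
      g = g' := by
    intro W g g' hg hr
    obtain ⟨a, ha⟩ := exists_preimage hS (g - g') (by rw [map_sub, hg, sub_self])
    obtain ⟨b, rfl⟩ := (hu W le_top).2 a
    have h0 : b = 0 := by
      apply (hF W).1
      apply (hu _ le_top).1
      have := hS.mono_f
      apply injective_of_mono S.f
      rw [map_naturality, map_naturality, ha, map_sub, hr, sub_self]
      simp
    rw [h0, map_zero, map_zero] at ha
    exact (sub_eq_zero.mp ha.symm)
  -- local lifts can be corrected by sections of `F` so as to agree with the given lift on `V`
  have hloc : ∀ x : X, ∃ W : Opens X, x ∈ W ∧ ∃ g : S.X₂.obj.obj (op W),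
      S.g.hom.app _ g = S.X₃.obj.map (homOfLE le_top).op q ∧
      S.X₂.obj.map (homOfLE inf_le_right).op g =
        S.X₂.obj.map (homOfLE (inf_le_left : V ⊓ W ≤ V)).op h₀ := by
    intro x
    obtain ⟨W, hW, hxW, g, hg⟩ := exists_local_lift hS q (show x ∈ ⊤ from trivial)
    obtain ⟨a, ha⟩ := exists_preimage hS (S.X₂.obj.map (homOfLE inf_le_right).op g -
        S.X₂.obj.map (homOfLE (inf_le_left : V ⊓ W ≤ V)).op h₀) (by
      rw [map_sub, map_naturality, map_naturality, hg, hh₀, map_map, map_map, sub_self])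
    obtain ⟨b, rfl⟩ := (hu _ le_top).2 a
    obtain ⟨b', rfl⟩ := (hF W).2 b
    refine ⟨W, hxW, g - S.f.hom.app _ (u.hom.app _ b'), ?_, ?_⟩
    · rw [map_sub, f_comp_g_apply, sub_zero, hg]
    · rw [map_sub, ← map_naturality, ← map_naturality, ha, sub_sub_cancel]
  choose W hxW g hg hgr using hloc
  obtain ⟨t, ht, -⟩ := TopCat.Sheaf.existsUnique_gluing' (S.X₂ : TopCat.Sheaf AddCommGrpCat X) W ⊤
    (fun x => homOfLE le_top) (fun x _ => Opens.mem_iSup.mpr ⟨x, hxW x⟩) g (by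
      intro x y
      apply hinj
      · erw [map_naturality, map_naturality]
        rw [hg, hg, map_map, map_map]
      · erw [map_map, map_map]
        rw [← map_map S.X₂.obj (inf_le_right : V ⊓ W x ≤ W x)
            (inf_le_inf_left V (inf_le_left : W x ⊓ W y ≤ W x)), hgr,
          ← map_map S.X₂.obj (inf_le_right : V ⊓ W y ≤ W y)
            (inf_le_inf_left V (inf_le_right : W x ⊓ W y ≤ W y)), hgr, map_map, map_map])
  refine ⟨t, eq_of_forall_nhds _ fun x _ => ⟨W x, le_top, hxW x, ?_⟩⟩
  rw [← map_naturality, ← hg x, ← ht x]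

end SheafLifting

/-! ### First cohomology -/

namespace SheafLifting

universe u
variable {X : TopCat.{u}}

open Abelian in
/-- The connecting map `H⁰ ⟶ H¹` sends a section that lifts to zero. -/
lemma comp_extClass_eq_zero_of_lift
    {S : ShortComplex (Sheaf (Opens.grothendieckTopology X) AddCommGrpCat.{u})}
    (hS : S.ShortExact) (x : Sheaf.H S.X₃ 0)
    (hx : ∃ g, S.g.hom.app (op ⊤) g = Sheaf.H.equiv₀ S.X₃ Limits.isTerminalTop x) :
    x.comp hS.extClass (zero_add 1) = 0 := by
  obtain ⟨g, hg⟩ := hx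
  have : Sheaf.H.map S.g 0 ((Sheaf.H.equiv₀ S.X₂ Limits.isTerminalTop).symm g) = x := by
    rw [Sheaf.H.equiv₀_symm_naturality, hg, AddEquiv.symm_apply_apply]
  rw [← this, Sheaf.H.map_apply, Ext.comp_assoc_of_second_deg_zero, hS.comp_extClass,
    Ext.comp_zero]

open Abelian in
/-- If global sections lift along every epimorphism with kernel `F`, then `H¹(X, F) = 0`. -/
lemma LiftsOver.subsingleton_H {F : Sheaf (Opens.grothendieckTopology X) AddCommGrpCat.{u}}
    (h : LiftsOver F ⊤) : Subsingleton (Sheaf.H F 1) := by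
  refine subsingleton_of_forall_eq 0 fun y => ?_
  -- in an embedding of `F` into an injective sheaf, all of `H¹(X, F)` comes from the connecting map
  let S : ShortComplex (Sheaf (Opens.grothendieckTopology X) AddCommGrpCat.{u}) :=
    ShortComplex.mk (Injective.ι F) (Limits.cokernel.π (Injective.ι F))
      (Limits.cokernel.condition _)
  have hS : S.ShortExact :=
    { exact := ShortComplex.exact_cokernel _
      mono_f := inferInstanceAs (Mono (Injective.ι F))
      epi_g := inferInstanceAs (Epi (Limits.cokernel.π (Injective.ι F))) }
  have : Injective S.X₂ := inferInstanceAs (Injective (Injective.under F))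
  obtain ⟨x, rfl⟩ := Ext.covariant_sequence_exact₁ _ hS y (Ext.eq_zero_of_injective _) (zero_add 1)
  exact comp_extClass_eq_zero_of_lift hS x
    (LiftsOver.surjective (S := S) h hS _)

open Abelian in
lemma subsingleton_H_of_shortExact
    {S : ShortComplex (Sheaf (Opens.grothendieckTopology X) AddCommGrpCat.{u})}
    (hS : S.ShortExact) (h₁ : Subsingleton (Sheaf.H S.X₁ 1)) (h₃ : Subsingleton (Sheaf.H S.X₃ 1)) :
    Subsingleton (Sheaf.H S.X₂ 1) := by
  refine subsingleton_of_forall_eq 0 fun y => ?_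
  obtain ⟨x, rfl⟩ := Ext.covariant_sequence_exact₂ _ hS y (Subsingleton.elim _ _)
  rw [Subsingleton.elim x 0, Ext.zero_comp]

end SheafLifting

/-! ### Sheaves of modules and their underlying abelian sheaves -/

namespace SheafLifting

section Epi

open Limits

/-- A functor `T` out of a reflective subcategory preserves epimorphisms as soon as its composition
with the reflector is right exact: the cokernel computed before reflecting is sent to zero. -/
lemma epi_map_of_reflective {C D E : Type*} [Category* C] [Category* D] [Category* E] [Abelian C]
    [Abelian D] [Abelian E] {a : C ⥤ D} {F : D ⥤ C} (adj : a ⊣ F) [IsIso adj.counit] (T : D ⥤ E)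
    [T.PreservesZeroMorphisms] [PreservesFiniteColimits (a ⋙ T)] {M N : D} (g : M ⟶ N) [Epi g] :
    Epi (T.map g) := by
  have hfac {M N : D} (g : M ⟶ N) :
      a.map (F.map g) = adj.counit.app M ≫ g ≫ inv (adj.counit.app N) := by
    rw [← Category.assoc, IsIso.eq_comp_inv]
    exact adj.counit.naturality g
  have : Epi (a.map (F.map g)) := by rw [hfac]; infer_instance
  have : a.IsLeftAdjoint := adj.isLeftAdjoint
  have : a.PreservesZeroMorphisms := inferInstance
  have : PreservesColimits a := adj.leftAdjoint_preservesColimits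
  let π := cokernel.π (F.map g)
  have hz : IsZero (a.obj (cokernel (F.map g))) := by
    have h : Epi (a.map π) := inferInstance
    have h0 : a.map π = 0 := by
      rw [← cancel_epi (a.map (F.map g)), ← a.map_comp, cokernel.condition, a.map_zero, comp_zero]
    exact IsZero.of_epi_eq_zero _ h0
  have hz' : IsZero ((a ⋙ T).obj (cokernel (F.map g))) := T.map_isZero hz
  have : Epi ((a ⋙ T).map (F.map g)) := by
    have := isColimitOfPreserves (a ⋙ T) (cokernelIsCokernel (F.map g))
    refine Preadditive.epi_of_isZero_cokernel' (CokernelCofork.map _ (a ⋙ T))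
      (CokernelCofork.mapIsColimit _ (cokernelIsCokernel (F.map g)) (a ⋙ T)) hz'
  have h2 : T.map g = inv (T.map (adj.counit.app M)) ≫ (a ⋙ T).map (F.map g) ≫
      T.map (adj.counit.app N) := by
    simp [hfac]
  rw [h2]
  infer_instance

end Epi

variable {X : Scheme.{0}}

/-- The abelian sheaf underlying a sheaf of modules. -/
noncomputable abbrev ab (X : Scheme.{0}) :
    X.Modules ⥤ Sheaf (Opens.grothendieckTopology X) AddCommGrpCat.{0} :=
  SheafOfModules.toSheaf X.ringCatSheaf

instance : (ab X).Additive := inferInstanceAs (SheafOfModules.toSheaf X.ringCatSheaf).Additive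

instance : Limits.PreservesFiniteLimits (ab X) :=
  inferInstanceAs (Limits.PreservesFiniteLimits (SheafOfModules.toSheaf X.ringCatSheaf))

/-- Epimorphisms of sheaves of modules are epimorphisms of abelian sheaves. -/
lemma epi_ab_map {M N : X.Modules} (g : M ⟶ N) [Epi g] : Epi ((ab X).map g) := by
  let adj := PresheafOfModules.sheafificationAdjunction (𝟙 X.ringCatSheaf.obj)
  have : Limits.PreservesFiniteColimits (PresheafOfModules.sheafification (𝟙 X.ringCatSheaf.obj) ⋙
    SheafOfModules.toSheaf X.ringCatSheaf) :=
    Limits.comp_preservesFiniteColimits (PresheafOfModules.toPresheaf _)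
      (presheafToSheaf _ AddCommGrpCat)
  have : Epi (C := SheafOfModules X.ringCatSheaf) g := ‹Epi g›
  exact epi_map_of_reflective adj (SheafOfModules.toSheaf X.ringCatSheaf) (M := M) (N := N) g

lemma shortExact_map_ab {S : ShortComplex X.Modules} (hS : S.ShortExact) :
    (S.map (ab X)).ShortExact where
  exact := hS.exact.map_of_mono_of_preservesKernel (ab X) hS.mono_f inferInstance
  mono_f := by
    have := hS.mono_f
    exact inferInstanceAs (Mono ((ab X).map S.f))
  epi_g := by
    have := hS.epi_g
    exact epi_ab_map S.g

lemma mono_of_app_injective {M N : X.Modules} (f : M ⟶ N)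
    (h : ∀ U : X.Opens, Function.Injective (f.app U)) : Mono f := by
  have : Mono f.mapPresheaf := by
    have : ∀ U, Mono (f.mapPresheaf.app U) := fun U =>
      (AddCommGrpCat.mono_iff_injective _).mpr (h U.unop)
    exact NatTrans.mono_of_mono_app _
  exact (Scheme.Modules.toPresheaf X).mono_of_mono_map this

lemma epi_of_locally_surjective {M N : X.Modules} (f : M ⟶ N)
    (h : ∀ (U : X.Opens) (n : Γ(N, U)), ∀ x ∈ U, ∃ (V : X.Opens) (hV : V ≤ U), x ∈ V ∧
      ∃ m : Γ(M, V), f.app V m = N.presheaf.map (homOfLE hV).op n) : Epi f := by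
  have : Epi ((ab X).map f) := by
    refine (TopCat.Sheaf.isLocallySurjective_iff_epi ((ab X).map f)).mp
      ((TopCat.Presheaf.isLocallySurjective_iff _).mpr fun U t x hx => ?_)
    obtain ⟨V, hV, hxV, m, hm⟩ := h U t x hx
    exact ⟨V, hV, ⟨m, hm⟩, hxV⟩
  have : Epi ((SheafOfModules.toSheaf X.ringCatSheaf).map f) := this
  exact Functor.epi_of_epi_map (SheafOfModules.toSheaf X.ringCatSheaf) this

/-- A morphism of sheaves of modules given by a relation between sections that is linear,
compatible with restrictions, and relates every section to exactly one section. -/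
lemma exists_hom_of_relation {M N : X.Modules} (R : ∀ U : X.Opens, Γ(M, U) → Γ(N, U) → Prop)
    (hadd : ∀ U x x' y y', R U x y → R U x' y' → R U (x + x') (y + y'))
    (hsmul : ∀ U (r : Γ(X, U)) x y, R U x y → R U (r • x) (r • y))
    (hmap : ∀ (U V : X.Opens) (h : V ≤ U) x y, R U x y →
      R V (M.presheaf.map (homOfLE h).op x) (N.presheaf.map (homOfLE h).op y))
    (hex : ∀ U x, ∃! y, R U x y) :
    ∃ φ : M ⟶ N, ∀ U x, R U x (φ.app U x) := by
  choose f hf huniq using hex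
  let φ : M ⟶ N := ⟨PresheafOfModules.homMk (M₁ := M.val) (M₂ := N.val)
    { app := fun U => AddCommGrpCat.ofHom
        { toFun := f U.unop
          map_zero' := (huniq _ _ _ (by
            have := hsmul _ (0 : Γ(X, U.unop)) _ _ (hf U.unop 0)
            rwa [zero_smul, zero_smul] at this)).symm
          map_add' := fun x x' => (huniq _ _ _ (hadd _ _ _ _ _ (hf _ x) (hf _ x'))).symm }
      naturality := fun U V i => by
        ext x
        exact (huniq _ _ _ (hmap U.unop V.unop (leOfHom i.unop) x _ (hf _ x))).symm }
    (fun U r x => (huniq _ _ _ (hsmul U.unop r x _ (hf _ x))).symm)⟩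
  exact ⟨φ, fun U x => hf U x⟩

lemma exists_factor {K M N : X.Modules} (ι : M ⟶ N) (hι : ∀ U, Function.Injective (ι.app U))
    (φ : K ⟶ N) (h : ∀ U x, ∃ y, ι.app U y = φ.app U x) : ∃ ψ : K ⟶ M, ψ ≫ ι = φ := by
  obtain ⟨ψ, hψ⟩ := exists_hom_of_relation (M := K) (N := M) (fun U x y => ι.app U y = φ.app U x)
    (fun U x x' y y' h h' => by rw [map_add, map_add, h, h'])
    (fun U r x y h => by rw [Scheme.Modules.Hom.app_smul, Scheme.Modules.Hom.app_smul, h])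
    (fun U V i x y h => by
      have h1 := map_naturality ι.mapPresheaf i y
      have h2 := map_naturality φ.mapPresheaf i x
      simp only [Scheme.Modules.mapPresheaf_app] at h1 h2
      erw [h1, h2, h])
    (fun U x => by
      obtain ⟨y, hy⟩ := h U x
      exact ⟨y, hy, fun z hz => hι U (hz.trans hy.symm)⟩)
  refine ⟨ψ, ?_⟩
  ext U x
  exact hψ U x

/-- A criterion for exactness in terms of sections. -/
lemma exact_of_sections {S : ShortComplex X.Modules}
    (hf : ∀ U, Function.Injective (S.f.app U))
    (h : ∀ U x, S.g.app U x = 0 → ∃ y, S.f.app U y = x) : S.Exact := by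
  have : Mono S.f := mono_of_app_injective _ hf
  refine ShortComplex.exact_of_f_is_kernel S (Limits.KernelFork.IsLimit.ofι' S.f S.zero
    fun {K} k hk => ?_)
  have := exists_factor S.f hf k fun U x => h U _ (by
    have := congrArg (fun t : K ⟶ S.X₃ => t.app U x) hk
    exact this)
  exact ⟨this.choose, this.choose_spec⟩

end SheafLifting

/-! ### Direct images from open subsets and the Čech sequence -/

namespace SheafLifting

variable {X : Scheme.{0}}

/-- Intersection with a fixed open subset. -/
def infFunctor (V : X.Opens) : X.Opens ⥤ X.Opens :=
  Monotone.functor (f := fun W => V ⊓ W) fun _ _ h => inf_le_inf_left V h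

instance (V : X.Opens) : (infFunctor V).IsContinuous (Opens.grothendieckTopology X)
    (Opens.grothendieckTopology X) := by
  have : (Opens.map V.ι.base ⋙ V.ι.opensFunctor).IsContinuous (Opens.grothendieckTopology X)
      (Opens.grothendieckTopology X) :=
    Functor.isContinuous_comp _ _ _ (Opens.grothendieckTopology V) _
  exact Functor.isContinuous_of_iso (F₁ := Opens.map V.ι.base ⋙ V.ι.opensFunctor)
    (NatIso.ofComponents (fun W => eqToIso (by
      exact (V.functor_map_eq_inf W).trans (inf_comm _ _))) fun _ => rfl) _ _

/-- The direct image of the restriction of sheaves of modules to an open subset `V`: its sections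
over `W` are the sections over `V ⊓ W`. -/
noncomputable def extendFrom (V : X.Opens) : X.Modules ⥤ X.Modules :=
  letI α : X.presheaf ⟶ (infFunctor V).op ⋙ X.presheaf :=
    { app := fun U => X.presheaf.map (homOfLE (inf_le_right : V ⊓ U.unop ≤ U.unop)).op
      naturality := fun U _ i => (X.presheaf.map_comp _ _).symm.trans
        (X.presheaf.map_comp (homOfLE (inf_le_right : V ⊓ U.unop ≤ U.unop)).op
          ((infFunctor V).op.map i)) }
  SheafOfModules.pushforward (F := infFunctor V)
    ⟨Functor.whiskerRight α (forget₂ CommRingCat RingCat)⟩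

variable (V : X.Opens) (M : X.Modules)

/-- Restriction of sections to `V`, as a morphism to the direct image. -/
noncomputable def toExtend : M ⟶ (extendFrom V).obj M :=
  ⟨PresheafOfModules.homMk (M₁ := M.val) (M₂ := ((extendFrom V).obj M).val)
    { app := fun U => M.presheaf.map (homOfLE (inf_le_right : V ⊓ U.unop ≤ U.unop)).op
      naturality := fun U _ i => (M.presheaf.map_comp _ _).symm.trans
        (M.presheaf.map_comp (homOfLE (inf_le_right : V ⊓ U.unop ≤ U.unop)).op
          ((infFunctor V).op.map i)) }
    (fun U r x => Scheme.Modules.map_smul M (homOfLE (inf_le_right : V ⊓ U.unop ≤ U.unop)) r x)⟩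

/-- Restriction from `V` to a smaller open subset, on direct images. -/
noncomputable def extendRes {V V' : X.Opens} (h : V' ≤ V) :
    (extendFrom V).obj M ⟶ (extendFrom V').obj M :=
  ⟨PresheafOfModules.homMk (M₁ := ((extendFrom V).obj M).val) (M₂ := ((extendFrom V').obj M).val)
    { app := fun U => M.presheaf.map (homOfLE (inf_le_inf_right U.unop h)).op
      naturality := fun U _ i => (M.presheaf.map_comp ((infFunctor V).op.map i) _).symm.trans
        (M.presheaf.map_comp (homOfLE (inf_le_inf_right U.unop h)).op
          ((infFunctor V').op.map i)) }
    (fun U r x => by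
      have h1 := Scheme.Modules.map_smul M (homOfLE (inf_le_inf_right U.unop h))
        (X.presheaf.map (homOfLE (inf_le_right : V ⊓ U.unop ≤ U.unop)).op r) x
      have h2 : X.presheaf.map (homOfLE (inf_le_inf_right U.unop h)).op
        (X.presheaf.map (homOfLE (inf_le_right : V ⊓ U.unop ≤ U.unop)).op r) =
          X.presheaf.map (homOfLE (inf_le_right : V' ⊓ U.unop ≤ U.unop)).op r :=
        ConcreteCategory.congr_hom (X.presheaf.map_comp (homOfLE _).op (homOfLE _).op).symm r
      rw [h2] at h1
      exact h1)⟩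

lemma toExtend_extendRes {V V' : X.Opens} (h : V' ≤ V) :
    toExtend V M ≫ extendRes M h = toExtend V' M := by
  ext W x
  exact map_map M.presheaf _ _ x

lemma toExtend_naturality {M N : X.Modules} (f : M ⟶ N) :
    toExtend V M ≫ (extendFrom V).map f = f ≫ toExtend V N := by
  ext W x
  exact map_naturality f.mapPresheaf inf_le_right x

lemma extendRes_naturality {M N : X.Modules} (f : M ⟶ N) {V V' : X.Opens} (h : V' ≤ V) :
    extendRes M h ≫ (extendFrom V').map f = (extendFrom V).map f ≫ extendRes N h := by
  ext W x
  exact map_naturality f.mapPresheaf (inf_le_inf_right W h) x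

lemma map_bijective_of_eq (F : TopCat.Presheaf AddCommGrpCat.{0} X) {U V : X.Opens} (h : V ≤ U)
    (h' : U ≤ V) : Function.Bijective (F.map (homOfLE h).op) := by
  obtain rfl := le_antisymm h h'
  refine ⟨fun x y hxy => ?_, fun x => ⟨x, map_self F h x⟩⟩
  rwa [map_self, map_self] at hxy

lemma liftsOver_top_extendFrom {V : X.Opens} {M : X.Modules} (h : LiftsOver ((ab X).obj M) V) :
    LiftsOver ((ab X).obj ((extendFrom V).obj M)) ⊤ := by
  refine LiftsOver.top (V := V) (h.of_bijective ((ab X).map (toExtend V M)) fun W hW => ?_)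
    fun W => ?_
  · exact map_bijective_of_eq M.presheaf _ (le_inf hW le_rfl)
  · have h : Function.Bijective (M.presheaf.map
        (homOfLE (inf_le_inf_left V (inf_le_right : V ⊓ W ≤ W))).op) :=
      map_bijective_of_eq M.presheaf _ (le_inf inf_le_left le_rfl)
    exact h

open Limits

/-- The Čech complex of a sheaf of modules for a covering by two open subsets, with its
augmentation: `0 ⟶ M ⟶ j₀₊ j₀* M ⊞ j₁₊ j₁* M ⟶ j₀₁₊ j₀₁* M ⟶ 0`. -/
noncomputable abbrev cech (V₀ V₁ : X.Opens) (M : X.Modules) : ShortComplex X.Modules :=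
  ShortComplex.mk (X₂ := (extendFrom V₀).obj M ⊞ (extendFrom V₁).obj M)
    (biprod.lift (toExtend V₀ M) (toExtend V₁ M))
    (biprod.desc (extendRes M (inf_le_left : V₀ ⊓ V₁ ≤ V₀)) (-extendRes M inf_le_right)) (by
      rw [biprod.lift_desc, Preadditive.comp_neg, toExtend_extendRes, toExtend_extendRes,
        add_neg_cancel])

lemma app_congr {M N : X.Modules} {f g : M ⟶ N} (h : f = g) (W : X.Opens) (x : Γ(M, W)) :
    f.app W x = g.app W x := by rw [h]

section

variable (V₀ V₁ : X.Opens) (M : X.Modules)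

/-- The first component of the middle term of the Čech complex. -/
noncomputable def cechFst : (cech V₀ V₁ M).X₂ ⟶ (extendFrom V₀).obj M := biprod.fst

/-- The second component of the middle term of the Čech complex. -/
noncomputable def cechSnd : (cech V₀ V₁ M).X₂ ⟶ (extendFrom V₁).obj M := biprod.snd

/-- The inclusion of the first summand of the middle term of the Čech complex. -/
noncomputable def cechInl : (extendFrom V₀).obj M ⟶ (cech V₀ V₁ M).X₂ := biprod.inl

/-- The inclusion of the second summand of the middle term of the Čech complex. -/
noncomputable def cechInr : (extendFrom V₁).obj M ⟶ (cech V₀ V₁ M).X₂ := biprod.inr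

lemma cech_f_fst : (cech V₀ V₁ M).f ≫ cechFst V₀ V₁ M = toExtend V₀ M := biprod.lift_fst _ _

lemma cech_f_snd : (cech V₀ V₁ M).f ≫ cechSnd V₀ V₁ M = toExtend V₁ M := biprod.lift_snd _ _

lemma cechInl_g : cechInl V₀ V₁ M ≫ (cech V₀ V₁ M).g = extendRes M inf_le_left :=
  biprod.inl_desc _ _

lemma cechInr_g : cechInr V₀ V₁ M ≫ (cech V₀ V₁ M).g = -extendRes M inf_le_right :=
  biprod.inr_desc _ _

lemma cech_total : cechFst V₀ V₁ M ≫ cechInl V₀ V₁ M + cechSnd V₀ V₁ M ≫ cechInr V₀ V₁ M =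
    𝟙 (cech V₀ V₁ M).X₂ := biprod.total

lemma cech_g_eq : (cech V₀ V₁ M).g =
    cechFst V₀ V₁ M ≫ extendRes M (inf_le_left : V₀ ⊓ V₁ ≤ V₀) -
      cechSnd V₀ V₁ M ≫ extendRes M (inf_le_right : V₀ ⊓ V₁ ≤ V₁) := by
  rw [← Category.id_comp (cech V₀ V₁ M).g, ← cech_total, Preadditive.add_comp, Category.assoc,
    Category.assoc, cechInl_g, cechInr_g, Preadditive.comp_neg, sub_eq_add_neg]

end

lemma cech_app_ext {V₀ V₁ : X.Opens} {M : X.Modules} {W : X.Opens}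
    {x y : Γ((cech V₀ V₁ M).X₂, W)} (h₁ : (cechFst V₀ V₁ M).app W x = (cechFst V₀ V₁ M).app W y)
    (h₂ : (cechSnd V₀ V₁ M).app W x = (cechSnd V₀ V₁ M).app W y) : x = y := by
  have key (z : Γ((cech V₀ V₁ M).X₂, W)) : z =
      (cechInl V₀ V₁ M).app W ((cechFst V₀ V₁ M).app W z) +
        (cechInr V₀ V₁ M).app W ((cechSnd V₀ V₁ M).app W z) :=
    (app_congr (cech_total V₀ V₁ M) W z).symm
  rw [key x, key y, h₁, h₂]

/-- The Čech sequence is exact for every sheaf of modules. The last map is an epimorphism because,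
locally on either of the two open subsets, one summand of the middle term is already the third. -/
lemma shortExact_cech {V₀ V₁ : X.Opens} (hV : V₀ ⊔ V₁ = ⊤) (M : X.Modules) :
    (cech V₀ V₁ M).ShortExact := by
  have hW (W : X.Opens) : W ≤ (V₀ ⊓ W) ⊔ (V₁ ⊓ W) := by
    rw [← inf_sup_right, hV, top_inf_eq]
  have hfst (W : X.Opens) (x : Γ(M, W)) :
      (cechFst V₀ V₁ M).app W ((cech V₀ V₁ M).f.app W x) = (toExtend V₀ M).app W x :=
    app_congr (cech_f_fst V₀ V₁ M) W x
  have hsnd (W : X.Opens) (x : Γ(M, W)) :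
      (cechSnd V₀ V₁ M).app W ((cech V₀ V₁ M).f.app W x) = (toExtend V₁ M).app W x :=
    app_congr (cech_f_snd V₀ V₁ M) W x
  have hinj (W : X.Opens) : Function.Injective ((cech V₀ V₁ M).f.app W) := by
    intro x y hxy
    have h₁ : (toExtend V₀ M).app W x = (toExtend V₀ M).app W y :=
      (hfst W x).symm.trans ((congrArg _ hxy).trans (hfst W y))
    have h₂ : (toExtend V₁ M).app W x = (toExtend V₁ M).app W y :=
      (hsnd W x).symm.trans ((congrArg _ hxy).trans (hsnd W y))
    refine eq_of_forall_nhds ((ab X).obj M) fun p hp => ?_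
    rcases hW W hp with hp | hp
    · exact ⟨_, inf_le_right, hp, h₁⟩
    · exact ⟨_, inf_le_right, hp, h₂⟩
  have hmono := mono_of_app_injective _ hinj
  refine { exact := exact_of_sections hinj fun W x hx => ?_, mono_f := hmono, epi_g := ?_ }
  · let x₀ : Γ(M, V₀ ⊓ W) := (cechFst V₀ V₁ M).app W x
    let x₁ : Γ(M, V₁ ⊓ W) := (cechSnd V₀ V₁ M).app W x
    have hx' : M.presheaf.map (homOfLE (inf_le_inf_right W inf_le_left)).op x₀ -
        M.presheaf.map (homOfLE (inf_le_inf_right W (inf_le_right : V₀ ⊓ V₁ ≤ V₁))).op x₁ = 0 :=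
      (app_congr (cech_g_eq V₀ V₁ M) W x).symm.trans hx
    have hle : (V₀ ⊓ W) ⊓ (V₁ ⊓ W) ≤ (V₀ ⊓ V₁) ⊓ W :=
      le_inf (inf_le_inf inf_le_left inf_le_left) (inf_le_left.trans inf_le_right)
    have hx'' := congrArg (M.presheaf.map (homOfLE hle).op) (sub_eq_zero.mp hx')
    rw [map_map, map_map] at hx''
    obtain ⟨y, hy₀, hy₁⟩ := exists_glue ((ab X).obj M) inf_le_right inf_le_right (hW W) x₀ x₁ hx''
    exact ⟨y, cech_app_ext ((hfst W y).trans hy₀) ((hsnd W y).trans hy₁)⟩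
  · refine epi_of_locally_surjective _ fun W (n : Γ(M, (V₀ ⊓ V₁) ⊓ W)) p hp => ?_
    rcases hW W hp with hp | hp
    · have h1 : V₁ ⊓ (V₀ ⊓ W) ≤ (V₀ ⊓ V₁) ⊓ W :=
        le_inf (le_inf (inf_le_right.trans inf_le_left) inf_le_left)
          (inf_le_right.trans inf_le_right)
      let m : Γ(M, V₁ ⊓ (V₀ ⊓ W)) := M.presheaf.map (homOfLE h1).op n
      let m' : Γ((extendFrom V₁).obj M, V₀ ⊓ W) := -m
      refine ⟨V₀ ⊓ W, inf_le_right, hp, (cechInr V₀ V₁ M).app _ m',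
        (app_congr (cechInr_g V₀ V₁ M) _ m').trans ?_⟩
      have h2 : -(M.presheaf.map (homOfLE (inf_le_inf_right (V₀ ⊓ W)
          (inf_le_right : V₀ ⊓ V₁ ≤ V₁))).op (-m)) = M.presheaf.map
            (homOfLE (inf_le_inf_left (V₀ ⊓ V₁) (inf_le_right : V₀ ⊓ W ≤ W))).op n := by
        rw [map_neg, neg_neg]
        exact map_map M.presheaf _ _ _
      exact h2
    · have h1 : V₀ ⊓ (V₁ ⊓ W) ≤ (V₀ ⊓ V₁) ⊓ W :=
        le_inf (le_inf inf_le_left (inf_le_right.trans inf_le_left))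
          (inf_le_right.trans inf_le_right)
      let m : Γ(M, V₀ ⊓ (V₁ ⊓ W)) := M.presheaf.map (homOfLE h1).op n
      let m' : Γ((extendFrom V₀).obj M, V₁ ⊓ W) := m
      refine ⟨V₁ ⊓ W, inf_le_right, hp, (cechInl V₀ V₁ M).app _ m',
        (app_congr (cechInl_g V₀ V₁ M) _ m').trans ?_⟩
      have h2 : M.presheaf.map (homOfLE (inf_le_inf_right (V₁ ⊓ W)
          (inf_le_left : V₀ ⊓ V₁ ≤ V₀))).op m = M.presheaf.map
            (homOfLE (inf_le_inf_left (V₀ ⊓ V₁) (inf_le_right : V₁ ⊓ W ≤ W))).op n :=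
        map_map M.presheaf _ _ _
      exact h2

end SheafLifting

/-! ### Extensions and Čech classes -/

namespace SheafLifting

variable {X : Scheme.{0}}

section Abstract

universe w
open Abelian Limits

variable {C : Type*} [Category* C] [Abelian C]

/-- The pushout of a short exact sequence along a morphism from its first term. -/
lemma exists_pushout_shortExact {S : ShortComplex C} (hS : S.ShortExact) {J : C} (η : S.X₁ ⟶ J) :
    ∃ (P : C) (j : J ⟶ P) (q : P ⟶ S.X₃) (w : j ≫ q = 0) (r : S.X₂ ⟶ P),
      (ShortComplex.mk j q w).ShortExact ∧ S.f ≫ r = η ≫ j ∧ r ≫ q = S.g := by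
  have hm := hS.mono_f
  have he := hS.epi_g
  let q : pushout η S.f ⟶ S.X₃ := pushout.desc 0 S.g (by rw [comp_zero, S.zero])
  have hl : pushout.inl η S.f ≫ q = 0 := pushout.inl_desc _ _ _
  have hr : pushout.inr η S.f ≫ q = S.g := pushout.inr_desc _ _ _
  refine ⟨pushout η S.f, pushout.inl η S.f, q, hl, pushout.inr η S.f, ?_,
    pushout.condition.symm, hr⟩
  have hg : Epi q := by
    have h2 : Epi (pushout.inr η S.f ≫ q) := by rw [hr]; exact he
    exact epi_of_epi (pushout.inr η S.f) q
  have hf : Mono (pushout.inl η S.f) := inferInstance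
  refine { exact := ?_, mono_f := hf, epi_g := hg }
  refine ShortComplex.exact_of_g_is_cokernel _ (CokernelCofork.IsColimit.ofπ' q hl
    fun {K} k hk => ?_)
  have h0 : S.f ≫ pushout.inr η S.f ≫ k = 0 := by
    rw [← pushout.condition_assoc, hk, comp_zero]
  refine ⟨hS.exact.desc (pushout.inr η S.f ≫ k) h0, ?_⟩
  apply pushout.hom_ext
  · rw [reassoc_of% hl, zero_comp, hk]
  · rw [reassoc_of% hr, hS.exact.g_desc]

variable [HasExt.{w} C]

lemma ext_comp_eq_zero_of_total {Y A K J₀ J₁ : C} {f : A ⟶ K} (p₀ : K ⟶ J₀) (p₁ : K ⟶ J₁)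
    (i₀ : J₀ ⟶ K) (i₁ : J₁ ⟶ K) (total : p₀ ≫ i₀ + p₁ ≫ i₁ = 𝟙 K) {n : ℕ} (x : Ext Y A n)
    (h₀ : x.comp (Ext.mk₀ (f ≫ p₀)) (add_zero n) = 0)
    (h₁ : x.comp (Ext.mk₀ (f ≫ p₁)) (add_zero n) = 0) :
    x.comp (Ext.mk₀ f) (add_zero n) = 0 := by
  have : f = (f ≫ p₀) ≫ i₀ + (f ≫ p₁) ≫ i₁ := by
    rw [Category.assoc, Category.assoc, ← Preadditive.comp_add, total, Category.comp_id]
  rw [this, Ext.mk₀_add, Ext.comp_add, ← Ext.mk₀_comp_mk₀ (f ≫ p₀) i₀,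
    ← Ext.mk₀_comp_mk₀ (f ≫ p₁) i₁, ← Ext.comp_assoc_of_third_deg_zero,
    ← Ext.comp_assoc_of_third_deg_zero, h₀, h₁, Ext.zero_comp, Ext.zero_comp, add_zero]

lemma comp_extClass_comp {T₁ T₂ : ShortComplex C} (h₁ : T₁.ShortExact) (h₂ : T₂.ShortExact)
    (φ : T₁ ⟶ T₂) {Y : C} (z : Ext Y T₁.X₃ 0) :
    (z.comp h₁.extClass (zero_add 1)).comp (Ext.mk₀ φ.τ₁) (add_zero 1) =
      (z.comp (Ext.mk₀ φ.τ₃) (add_zero 0)).comp h₂.extClass (zero_add 1) := by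
  rw [Ext.comp_assoc_of_third_deg_zero, ShortComplex.ShortExact.extClass_naturality h₁ h₂ φ,
    Ext.comp_assoc_of_second_deg_zero]

end Abstract

section Sections

/-- The structure sheaf as a sheaf of modules. -/
noncomputable def structureSheaf (X : Scheme.{0}) : X.Modules :=
  SheafOfModules.unit X.ringCatSheaf

/-- The global section corresponding to a morphism from the structure sheaf. -/
noncomputable def evalOne (M : X.Modules) (f : structureSheaf X ⟶ M) : Γ(M, ⊤) :=
  f.app ⊤ (show Γ(structureSheaf X, ⊤) from (1 : Γ(X, ⊤)))

lemma structureSheaf_app {M : X.Modules} (f : structureSheaf X ⟶ M) (U : X.Opens) (r : Γ(X, U)) :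
    f.app U (show Γ(structureSheaf X, U) from r) =
      r • M.presheaf.map (homOfLE le_top).op (evalOne M f) := by
  have h1 := map_naturality f.mapPresheaf (le_top : U ≤ ⊤)
    (show Γ(structureSheaf X, ⊤) from (1 : Γ(X, ⊤)))
  have h2 : (structureSheaf X).presheaf.map (homOfLE (le_top : U ≤ ⊤)).op
      (show Γ(structureSheaf X, ⊤) from (1 : Γ(X, ⊤))) =
        (show Γ(structureSheaf X, U) from (1 : Γ(X, U))) :=
    map_one (X.presheaf.map (homOfLE (le_top : U ≤ ⊤)).op).hom
  have h3 := Scheme.Modules.Hom.app_smul f r (show Γ(structureSheaf X, U) from (1 : Γ(X, U)))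
  have h4 : r • (show Γ(structureSheaf X, U) from (1 : Γ(X, U))) =
    (show Γ(structureSheaf X, U) from r) := mul_one r
  rw [h4] at h3
  rw [h2] at h1
  exact h3.trans (congrArg (r • ·) h1)

lemma evalOne_injective (M : X.Modules) : Function.Injective (evalOne M) := by
  intro f g h
  ext U x
  have h' : (show Γ(X, U) from x) • M.presheaf.map (homOfLE (le_top : U ≤ ⊤)).op (evalOne M f) =
      (show Γ(X, U) from x) • M.presheaf.map (homOfLE (le_top : U ≤ ⊤)).op (evalOne M g) := by
    rw [h]
  exact (structureSheaf_app f U x).trans (h'.trans (structureSheaf_app g U x).symm)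

lemma evalOne_surjective (M : X.Modules) : Function.Surjective (evalOne M) := by
  intro s
  obtain ⟨f, hf⟩ := exists_hom_of_relation (M := structureSheaf X) (N := M)
    (fun U x y => y = (show Γ(X, U) from x) • M.presheaf.map (homOfLE le_top).op s)
    (by
        rintro U x x' y y' rfl rfl
        exact (add_smul (show Γ(X, U) from x) (show Γ(X, U) from x') _).symm)
    (by rintro U r x y rfl; exact (mul_smul r (show Γ(X, U) from x) _).symm)
    (by
      rintro U V h x y rfl
      rw [Scheme.Modules.map_smul, map_map]
      rfl)
    (fun U x => ⟨_, rfl, fun y hy => hy⟩)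
  refine ⟨f, (hf ⊤ _).trans ?_⟩
  erw [one_smul]
  exact map_self M.presheaf _ s

end Sections

section Extension

universe w
open Abelian

variable [HasExt.{w} X.Modules]

/-- If the first cohomology of `J` vanishes, then products of sections with the class of an
extension die in the pushout extension along any `η : S.X₁ ⟶ J`, because sections lift to that
pushout. -/
lemma lift_comp_extClass_comp_eq_zero {S : ShortComplex X.Modules} (hS : S.ShortExact)
    {J : X.Modules} (η : S.X₁ ⟶ J) (hJ : LiftsOver ((ab X).obj J) ⊤)
    (s : structureSheaf X ⟶ S.X₃) :
    ((Ext.mk₀ s).comp hS.extClass (zero_add 1)).comp (Ext.mk₀ η) (add_zero 1) = 0 := by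
  obtain ⟨P, j, q, w, r, hP, h₁, h₂⟩ := exists_pushout_shortExact hS η
  let φ : S ⟶ ShortComplex.mk j q w := ⟨η, r, 𝟙 _, h₁.symm, by simpa using h₂⟩
  have hnat : hS.extClass.comp (Ext.mk₀ η) (add_zero 1) = hP.extClass := by
    have := ShortComplex.ShortExact.extClass_naturality hS hP φ
    simpa [φ] using this
  obtain ⟨t, ht⟩ := LiftsOver.surjective (S := (ShortComplex.mk j q w).map (ab X)) hJ
    (shortExact_map_ab hP) (evalOne _ s)
  obtain ⟨t', rfl⟩ := evalOne_surjective P t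
  have hs : t' ≫ q = s := evalOne_injective _ ht
  rw [Ext.comp_assoc_of_third_deg_zero, hnat, ← hs, ← Ext.mk₀_comp_mk₀,
    Ext.comp_assoc_of_second_deg_zero]
  have h0 := hP.comp_extClass
  dsimp only at h0
  rw [h0, Ext.comp_zero]

variable {V₀ V₁ : X.Opens} (hV : V₀ ⊔ V₁ = ⊤)

include hV in
/-- The products of a section of the third term with the class of an extension come from the Čech
complex of the first term. -/
lemma exists_cech_representative {S : ShortComplex X.Modules} (hS : S.ShortExact)
    (h₀ : LiftsOver ((ab X).obj ((extendFrom V₀).obj S.X₁)) ⊤)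
    (h₁ : LiftsOver ((ab X).obj ((extendFrom V₁).obj S.X₁)) ⊤)
    (s : structureSheaf X ⟶ S.X₃) :
    ∃ α : structureSheaf X ⟶ (extendFrom (V₀ ⊓ V₁)).obj S.X₁,
      (Ext.mk₀ α).comp (shortExact_cech hV S.X₁).extClass (zero_add 1) =
        (Ext.mk₀ s).comp hS.extClass (zero_add 1) := by
  have hc := shortExact_cech hV S.X₁
  obtain ⟨x, hx⟩ := Ext.covariant_sequence_exact₁ _ hc
    ((Ext.mk₀ s).comp hS.extClass (zero_add 1))
    (ext_comp_eq_zero_of_total _ _ _ _ (cech_total V₀ V₁ S.X₁) _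
      (by rw [cech_f_fst]; exact lift_comp_extClass_comp_eq_zero hS _ h₀ s)
      (by rw [cech_f_snd]; exact lift_comp_extClass_comp_eq_zero hS _ h₁ s)) (zero_add 1)
  obtain ⟨α, rfl⟩ := (Ext.mk₀_bijective _ _).2 x
  exact ⟨α, hx⟩

/-- Functoriality of the Čech complex. -/
noncomputable def cechMap (V₀ V₁ : X.Opens) {M N : X.Modules} (f : M ⟶ N) :
    cech V₀ V₁ M ⟶ cech V₀ V₁ N where
  τ₁ := f
  τ₂ := Limits.biprod.map ((extendFrom V₀).map f) ((extendFrom V₁).map f)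
  τ₃ := (extendFrom (V₀ ⊓ V₁)).map f
  comm₁₂ := by
    apply Limits.biprod.hom_ext <;> simp [toExtend_naturality]
  comm₂₃ := by
    apply Limits.biprod.hom_ext' <;> simp [extendRes_naturality]

include hV in
/-- If the connecting map `s ↦ s ∘ e` of an extension `e` reaches all Čech classes of the first
term, then the first cohomology of the middle term vanishes. -/
theorem subsingleton_H_of_connecting_surjective {S : ShortComplex X.Modules} (hS : S.ShortExact)
    (h₀ : LiftsOver ((ab X).obj ((extendFrom V₀).obj S.X₁)) ⊤)
    (h₁ : LiftsOver ((ab X).obj ((extendFrom V₁).obj S.X₁)) ⊤)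
    (h₃ : LiftsOver ((ab X).obj S.X₃) ⊤)
    (hsurj : ∀ α : structureSheaf X ⟶ (extendFrom (V₀ ⊓ V₁)).obj S.X₁,
      ∃ s : structureSheaf X ⟶ S.X₃,
        (Ext.mk₀ s).comp hS.extClass (zero_add 1) =
          (Ext.mk₀ α).comp (shortExact_cech hV S.X₁).extClass (zero_add 1)) :
    Subsingleton (ModuleSheaf.H S.X₂ 1) := by
  have hS' := shortExact_map_ab hS
  have hcA := shortExact_cech hV S.X₁
  have hcE := shortExact_cech hV S.X₂
  have hcA' := shortExact_map_ab hcA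
  have hcE' := shortExact_map_ab hcE
  refine subsingleton_of_forall_eq 0 fun y => ?_
  obtain ⟨x, rfl⟩ := Ext.covariant_sequence_exact₂ _ hS' y (h₃.subsingleton_H.elim _ _)
  have htot : (ab X).map (cechFst V₀ V₁ S.X₁) ≫ (ab X).map (cechInl V₀ V₁ S.X₁) +
      (ab X).map (cechSnd V₀ V₁ S.X₁) ≫ (ab X).map (cechInr V₀ V₁ S.X₁) = 𝟙 _ := by
    rw [← Functor.map_comp, ← Functor.map_comp, ← Functor.map_add, cech_total]
    exact (ab X).map_id _
  obtain ⟨z, rfl⟩ := Ext.covariant_sequence_exact₁ _ hcA' x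
    (ext_comp_eq_zero_of_total _ _ _ _ htot x (h₀.subsingleton_H.elim _ _)
      (h₁.subsingleton_H.elim _ _)) (zero_add 1)
  obtain ⟨α, hα⟩ := evalOne_surjective _ (Sheaf.H.equiv₀ _ Limits.isTerminalTop z)
  obtain ⟨s, hs⟩ := hsurj α
  -- the Čech class of `α` dies in the middle term, because it is a multiple of the extension class
  have hdie : (Ext.mk₀ (α ≫ (extendFrom (V₀ ⊓ V₁)).map S.f)).comp hcE.extClass (zero_add 1) =
      0 := by
    have hnat := comp_extClass_comp hcA hcE (cechMap V₀ V₁ S.f) (Ext.mk₀ α)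
    rw [Ext.mk₀_comp_mk₀] at hnat
    refine hnat.symm.trans ?_
    rw [← hs]
    have h0 : hS.extClass.comp (Ext.mk₀ (cechMap V₀ V₁ S.f).τ₁) (add_zero 1) = 0 :=
      hS.extClass_comp
    exact (Ext.comp_assoc_of_third_deg_zero _ _ _ _).trans (by rw [h0, Ext.comp_zero])
  obtain ⟨β', hβ'⟩ := Ext.covariant_sequence_exact₃ _ hcE _ (zero_add 1) hdie
  obtain ⟨β, rfl⟩ := (Ext.mk₀_bijective _ _).2 β'
  rw [Ext.mk₀_comp_mk₀] at hβ'
  have hβ := (Ext.mk₀_bijective _ _).1 hβ'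
  refine (comp_extClass_comp hcA' hcE'
    ((ab X).mapShortComplex.map (cechMap V₀ V₁ S.f)) z).trans ?_
  refine comp_extClass_eq_zero_of_lift hcE' _ ⟨evalOne _ β, ?_⟩
  have h5 := Sheaf.H.equiv₀_naturality (hT := Limits.isTerminalTop)
    ((ab X).map ((extendFrom (V₀ ⊓ V₁)).map S.f)) z
  refine Eq.trans ?_ h5
  refine Eq.trans (congrArg (evalOne _) hβ) ?_
  exact congrArg (ConcreteCategory.hom
    (((ab X).map ((extendFrom (V₀ ⊓ V₁)).map S.f)).hom.app (op ⊤))) hα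

end Extension

end SheafLifting

/-! ### Line bundles on affine open sets -/

namespace SheafLifting

variable {X : Scheme.{0}}

lemma fun_map_map {U V W : X.Opens} (h : V ≤ U) (h' : W ≤ V) (s : Γ(X, U)) :
    X.presheaf.map (homOfLE h').op (X.presheaf.map (homOfLE h).op s) =
      X.presheaf.map (homOfLE (h'.trans h)).op s := by
  rw [← CommRingCat.comp_apply, ← Functor.map_comp]
  rfl

lemma isUnit_map_basicOpen {U : X.Opens} (f : Γ(X, U)) :
    IsUnit (X.presheaf.map (homOfLE (X.basicOpen_le f)).op f) :=
  X.toRingedSpace.isUnit_res_basicOpen f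

/-- If `f` and `g` are coprime functions on an affine open set, every function on
`{f ≠ 0} ∩ {g ≠ 0}` is a sum of functions on `{f ≠ 0}` and `{g ≠ 0}`. -/
lemma exists_add_of_isCoprime {V V₁ V₂ W : X.Opens} (hV : IsAffineOpen V) {f g : Γ(X, V)}
    (hfg : IsCoprime f g) (h₁ : V₁ = X.basicOpen f) (h₂ : V₂ = X.basicOpen g)
    (hW : W = X.basicOpen (f * g)) (hW₁ : W ≤ V₁) (hW₂ : W ≤ V₂) (r : Γ(X, W)) :
    ∃ (r₁ : Γ(X, V₁)) (r₂ : Γ(X, V₂)), r = X.presheaf.map (homOfLE hW₁).op r₁ +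
      X.presheaf.map (homOfLE hW₂).op r₂ := by
  subst h₁ h₂ hW
  have hle := X.basicOpen_le (f * g)
  obtain ⟨n, y, hy⟩ := exists_eq_pow_mul_of_isAffineOpen X V hV (f * g) r
  dsimp only [TopCat.Presheaf.restrictOpenCommRingCat_apply] at hy
  obtain ⟨p, q, hpq⟩ := hfg.pow (m := n) (n := n)
  obtain ⟨f', hf'⟩ := (isUnit_map_basicOpen f).exists_right_inv
  obtain ⟨g', hg'⟩ := (isUnit_map_basicOpen g).exists_right_inv
  have hu := isUnit_map_basicOpen (f * g)
  refine ⟨X.presheaf.map (homOfLE (X.basicOpen_le f)).op (q * y) * f' ^ n,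
    X.presheaf.map (homOfLE (X.basicOpen_le g)).op (p * y) * g' ^ n, ?_⟩
  have hF := congrArg (X.presheaf.map (homOfLE hW₁).op) hf'
  have hG := congrArg (X.presheaf.map (homOfLE hW₂).op) hg'
  replace hpq := congrArg (X.presheaf.map (homOfLE hle).op) hpq
  change X.presheaf.map (homOfLE hle).op y = X.presheaf.map (homOfLE hle).op (f * g) ^ n * r at hy
  refine (hu.pow n).mul_right_injective ?_
  simp only [map_mul, map_pow, map_one, map_add, fun_map_map] at hF hG hpq hy ⊢
  rw [← hy]
  generalize X.presheaf.map (homOfLE hle).op f = F at *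
  generalize X.presheaf.map (homOfLE hle).op g = G at *
  generalize X.presheaf.map (homOfLE hW₁).op f' = F' at *
  generalize X.presheaf.map (homOfLE hW₂).op g' = G' at *
  generalize X.presheaf.map (homOfLE hle).op p = P at *
  generalize X.presheaf.map (homOfLE hle).op q = Q at *
  generalize X.presheaf.map (homOfLE hle).op y = Y at *
  have hFn : F ^ n * F' ^ n = 1 := by rw [← mul_pow, hF, one_pow]
  have hGn : G ^ n * G' ^ n = 1 := by rw [← mul_pow, hG, one_pow]
  linear_combination (-Y) * hpq - Q * Y * G ^ n * hFn - P * Y * F ^ n * hGn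

variable {M : X.Modules} {U : X.Opens} {e : Γ(M, U)}

lemma _root_.ModuleSheaf.IsFreeGenerator.exists_add (he : ModuleSheaf.IsFreeGenerator M U e)
    {V V₁ V₂ W : X.Opens} (hVU : V ≤ U) (hV : IsAffineOpen V) {f g : Γ(X, V)}
    (hfg : IsCoprime f g) (h₁ : V₁ = X.basicOpen f) (h₂ : V₂ = X.basicOpen g)
    (hW : W = X.basicOpen (f * g)) (hW₁ : W ≤ V₁) (hW₂ : W ≤ V₂) (a : Γ(M, W)) :
    ∃ (a₁ : Γ(M, V₁)) (a₂ : Γ(M, V₂)), a = M.presheaf.map (homOfLE hW₁).op a₁ -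
      M.presheaf.map (homOfLE hW₂).op a₂ := by
  have hV₁ : V₁ ≤ U := h₁ ▸ (X.basicOpen_le f).trans hVU
  have hV₂ : V₂ ≤ U := h₂ ▸ (X.basicOpen_le g).trans hVU
  obtain ⟨r, rfl⟩ := (he W (hW₁.trans hV₁)).2 a
  obtain ⟨r₁, r₂, rfl⟩ := exists_add_of_isCoprime hV hfg h₁ h₂ hW hW₁ hW₂ r
  refine ⟨r₁ • M.presheaf.map (homOfLE hV₁).op e, -(r₂ • M.presheaf.map (homOfLE hV₂).op e), ?_⟩
  dsimp only
  rw [map_neg, sub_neg_eq_add, Scheme.Modules.map_smul, Scheme.Modules.map_smul, add_smul,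
    map_map, map_map]

/-- Free sheaves of rank one have no first cohomology on affine open sets. For a section `q` to be
lifted, the functions `f` such that `q` lifts over `{f ≠ 0}` form an ideal, which is the unit
ideal because `q` lifts locally. -/
lemma liftsOver_of_isAffineOpen (hU : IsAffineOpen U) (he : ModuleSheaf.IsFreeGenerator M U e) :
    LiftsOver ((ab X).obj M) U := by
  intro S hS u hu q
  let I : Ideal Γ(X, U) :=
    { carrier := {f | ∃ t : S.X₂.obj.obj (op (X.basicOpen f)),
        S.g.hom.app _ t = S.X₃.obj.map (homOfLE (X.basicOpen_le f)).op q}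
      zero_mem' := by
        refine ⟨0, eq_of_forall_nhds _ fun x hx => ?_⟩
        rw [X.basicOpen_zero] at hx
        exact hx.elim
      smul_mem' := by
        rintro r f ⟨t, ht⟩
        have hle : X.basicOpen (r • f) ≤ X.basicOpen f := by
          rw [smul_eq_mul, X.basicOpen_mul]; exact inf_le_right
        refine ⟨S.X₂.obj.map (homOfLE hle).op t, ?_⟩
        rw [map_naturality, ht, map_map]
      add_mem' := by
        rintro f g ⟨t, ht⟩ ⟨t', ht'⟩
        have hle := X.basicOpen_le (f + g)
        have hV : IsAffineOpen (X.basicOpen (f + g)) := hU.basicOpen _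
        obtain ⟨c, hc⟩ := (isUnit_map_basicOpen (f + g)).exists_right_inv
        -- on `{f + g ≠ 0}` the functions `f` and `g` generate the unit ideal
        have hfg : IsCoprime (X.presheaf.map (homOfLE hle).op f)
            (X.presheaf.map (homOfLE hle).op g) :=
          ⟨c, c, by rw [← hc, map_add]; ring⟩
        have e₁ := X.basicOpen_res f (homOfLE hle).op
        have e₂ := X.basicOpen_res g (homOfLE hle).op
        refine exists_lift_sup hS (V₁ := X.basicOpen (f + g) ⊓ X.basicOpen f)
          (V₂ := X.basicOpen (f + g) ⊓ X.basicOpen g) inf_le_left inf_le_left ?_ _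
          (S.X₂.obj.map (homOfLE inf_le_right).op t) ?_
          (S.X₂.obj.map (homOfLE inf_le_right).op t') ?_ fun a => ?_
        · rw [← inf_sup_left]
          exact le_inf le_rfl (X.basicOpen_add_le f g)
        · rw [map_naturality, ht, map_map, map_map]
        · rw [map_naturality, ht', map_map, map_map]
        · have hWU : X.basicOpen (f + g) ⊓ X.basicOpen f ⊓
              (X.basicOpen (f + g) ⊓ X.basicOpen g) ≤ U :=
            (inf_le_left.trans inf_le_left).trans hle
          obtain ⟨b, rfl⟩ := (hu _ hWU).2 a
          obtain ⟨b₁, b₂, hb⟩ := he.exists_add hle hV hfg e₁.symm e₂.symm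
            (by rw [X.basicOpen_mul, e₁, e₂]) inf_le_left inf_le_right b
          refine ⟨u.hom.app _ b₁, u.hom.app _ b₂, ?_⟩
          refine (congrArg _ hb).trans ((map_sub _ _ _).trans ?_)
          exact congrArg₂ (· - ·) (map_naturality u.hom _ b₁) (map_naturality u.hom _ b₂) }
  have hI : I = ⊤ := by
    rw [← Ideal.span_eq I, ← hU.iSup_basicOpen_eq_self_iff]
    refine le_antisymm (iSup_le fun f => X.basicOpen_le _) fun x hx => ?_
    obtain ⟨W, hWU, hxW, t, ht⟩ := exists_local_lift hS q hx
    obtain ⟨f, hf, hxf⟩ := hU.exists_basicOpen_le (⟨x, hxW⟩ : W) hx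
    refine Opens.mem_iSup.mpr ⟨⟨f, S.X₂.obj.map (homOfLE hf).op t, ?_⟩, hxf⟩
    rw [map_naturality, ht, map_map]
  obtain ⟨t, ht⟩ := (Ideal.eq_top_iff_one I).mp hI
  have h1 : U ≤ X.basicOpen (1 : Γ(X, U)) := by
    rw [X.basicOpen_of_isUnit isUnit_one]
  refine ⟨S.X₂.obj.map (homOfLE h1).op t, ?_⟩
  rw [map_naturality, ht, map_map]
  exact map_self _ _ _

end SheafLifting

/-! ### Geometry of the Hirzebruch surface -/

namespace HirzebruchOne

instance (σ : Cell) : IsDomain (coordRing σ) := NoZeroDivisors.to_isDomain _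

lemma mem_chart_iff {σ : Cell} {x : F1} : x ∈ chart σ ↔ ∃ y, incl σ y = x := by
  constructor
  · rintro ⟨y, -, rfl⟩
    exact ⟨y, rfl⟩
  · rintro ⟨y, rfl⟩
    exact ⟨y, trivial, rfl⟩

lemma exists_mem_chart (x : F1) : ∃ σ, x ∈ chart σ := by
  obtain ⟨σ, y, hy⟩ := Scheme.IsLocallyDirected.ι_jointly_surjective diagram x
  exact ⟨σ, mem_chart_iff.mpr ⟨y, hy⟩⟩

lemma chart_inf {σ τ ν : Cell} (h : ν.1 = σ.1 ∩ τ.1) : chart σ ⊓ chart τ = chart ν := by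
  have hσ : ν ≤ σ := by
    change ν.1 ⊆ σ.1
    rw [h]; exact Finset.inter_subset_left
  have hτ : ν ≤ τ := by
    change ν.1 ⊆ τ.1
    rw [h]; exact Finset.inter_subset_right
  refine le_antisymm ?_ (le_inf (chart_mono hσ) (chart_mono hτ))
  rintro x ⟨hx, hx'⟩
  obtain ⟨y, rfl⟩ := mem_chart_iff.mp hx
  obtain ⟨y', hy⟩ := mem_chart_iff.mp hx'
  obtain ⟨κ, f, g, w, rfl, rfl⟩ := (Scheme.IsLocallyDirected.ι_eq_ι_iff diagram).mp hy.symm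
  refine chart_mono (σ := κ) (τ := ν) ?_ (mem_chart_iff.mpr ⟨w, ?_⟩)
  · change κ.1 ⊆ ν.1
    rw [h]
    exact Finset.subset_inter (leOfHom f) (leOfHom g)
  · have : diagram.map f ≫ incl σ = incl κ := Limits.colimit.w diagram f
    rw [← this]; rfl

lemma isAffineOpen_chart (σ : Cell) : IsAffineOpen (chart σ) :=
  (isAffineOpen_top _).image_of_isOpenImmersion _

/-- The isomorphism underlying `chartFun`. -/
noncomputable def chartIso (σ : Cell) : CommRingCat.of (coordRing σ) ≅ Γ(F1, chart σ) :=
  (Scheme.ΓSpecIso (.of (coordRing σ))).symm ≪≫ ((incl σ).appIso ⊤).symm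

lemma chartFun_bijective (σ : Cell) : Function.Bijective (chartFun σ) :=
  (chartIso σ).commRingCatIsoToRingEquiv.bijective

lemma le_preimage_chart (σ : Cell) : ⊤ ≤ (incl σ) ⁻¹ᵁ (chart σ) :=
  ((incl σ).preimage_image_eq ⊤).ge

/-- Functions on a chart are compared after pulling them back to `Spec` of the coordinate ring. -/
lemma chartFun_eq_iff {σ : Cell} {x : Γ(F1, chart σ)} {f : coordRing σ} :
    x = chartFun σ f ↔ (incl σ).appLE (chart σ) ⊤ (le_preimage_chart σ) x =
      (Scheme.ΓSpecIso (.of (coordRing σ))).inv f := by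
  have h := (incl σ).appIso_hom' ⊤
  have h2 : (incl σ).appLE (chart σ) ⊤ (le_preimage_chart σ) (chartFun σ f) =
      (Scheme.ΓSpecIso (.of (coordRing σ))).inv f := by
    change ((Scheme.ΓSpecIso (.of (coordRing σ))).inv ≫ ((incl σ).appIso ⊤).inv ≫
      (incl σ).appLE (incl σ ''ᵁ ⊤) ⊤ (le_preimage_chart σ)) f = _
    rw [← h, Iso.inv_hom_id, Category.comp_id]
  constructor
  · rintro rfl
    exact h2
  · intro hx
    have hinj : Function.Injective ((incl σ).appLE (incl σ ''ᵁ ⊤) ⊤ (le_preimage_chart σ)) := by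
      rw [← h]
      exact ((incl σ).appIso ⊤).commRingCatIsoToRingEquiv.injective
    exact hinj (hx.trans h2.symm)

lemma SpecMap_appLE_top {R S : CommRingCat.{0}} (g : R ⟶ S) {e} (f : R) :
    (Spec.map g).appLE ⊤ ⊤ e ((Scheme.ΓSpecIso R).inv f) = (Scheme.ΓSpecIso S).inv (g f) := by
  have := ConcreteCategory.congr_hom (Scheme.ΓSpecIso_inv_naturality g) f
  refine Eq.trans ?_ this.symm
  rw [CommRingCat.comp_apply, Scheme.Hom.appTop, Scheme.Hom.app_eq_appLE]
  rfl

lemma SpecMap_comp_appLE_top {R S : CommRingCat.{0}} {X : Scheme.{0}} (g : R ⟶ S) (φ : Spec R ⟶ X)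
    {ψ : Spec S ⟶ X} (h : Spec.map g ≫ φ = ψ) {U : X.Opens} (e) (e') {x : Γ(X, U)} {f : R}
    (hx : φ.appLE U ⊤ e x = (Scheme.ΓSpecIso R).inv f) :
    ψ.appLE U ⊤ e' x = (Scheme.ΓSpecIso S).inv (g f) := by
  subst h
  rw [← Scheme.Hom.appLE_comp_appLE _ _ _ ⊤ _ e le_top, CommRingCat.comp_apply, hx]
  exact SpecMap_appLE_top g f

lemma map_chartFun {σ τ : Cell} (h : σ ≤ τ) (f : coordRing τ) :
    F1.presheaf.map (homOfLE (chart_mono h)).op (chartFun τ f) = chartFun σ (restr h f) := by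
  have h1 := chartFun_eq_iff.mp (rfl : chartFun τ f = chartFun τ f)
  rw [chartFun_eq_iff, ← CommRingCat.comp_apply, Scheme.Hom.map_appLE]
  exact SpecMap_comp_appLE_top (CommRingCat.ofHom (restr h)) (incl τ)
    (Limits.colimit.w diagram (homOfLE h)) _ _ h1

/-- A complex number as a global function on `𝔽₁`. -/
noncomputable def const : ℂ →+* Γ(F1, ⊤) :=
  ((Scheme.ΓSpecIso (.of ℂ)).inv ≫ structureMap.appTop).hom

lemma resTop_const (c : ℂ) (σ : Cell) :
    ModuleSheaf.resTop (const c) (chart σ) = chartFun σ (algebraMap ℂ _ c) := by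
  have hw : incl σ ≫ structureMap = Spec.map (CommRingCat.ofHom (algebraMap ℂ (coordRing σ))) :=
    Limits.colimit.ι_desc _ _
  have key {φ : Spec (.of (coordRing σ)) ⟶ Spec (.of ℂ)} (h : incl σ ≫ structureMap = φ) :
      (incl σ).appLE (chart σ) ⊤ (le_preimage_chart σ) (ModuleSheaf.resTop (const c) (chart σ)) =
        φ.appLE ⊤ ⊤ le_top ((Scheme.ΓSpecIso (.of ℂ)).inv c) := by
    subst h
    change (structureMap.appTop ≫ F1.presheaf.map _ ≫ (incl σ).appLE (chart σ) ⊤ _) _ = _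
    rw [Scheme.Hom.map_appLE]
    exact (ConcreteCategory.congr_hom (Scheme.Hom.comp_appLE (incl σ) structureMap ⊤ ⊤ _) _).symm
  rw [chartFun_eq_iff, key hw]
  exact SpecMap_appLE_top (R := .of ℂ) (CommRingCat.ofHom (algebraMap ℂ (coordRing σ))) c

lemma isIrreducible_chart (σ : Cell) : IsIrreducible (chart σ : Set F1) := by
  have : IrreducibleSpace (Spec (.of (coordRing σ))) :=
    inferInstanceAs (IrreducibleSpace (PrimeSpectrum (coordRing σ)))
  have h := (IrreducibleSpace.isIrreducible_univ (Spec (.of (coordRing σ)))).image (incl σ)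
    (incl σ).continuous.continuousOn
  exact h

/-- The torus is irreducible and dense in `𝔽₁`. -/
lemma irreducibleSpace_F1 : IrreducibleSpace F1 := by
  have hT := isIrreducible_chart emptyCell
  have hd : closure (chart emptyCell : Set F1) = Set.univ := by
    refine Set.eq_univ_of_forall fun x => ?_
    obtain ⟨σ, hσ⟩ := exists_mem_chart x
    have := subset_closure_inter_of_isPreirreducible_of_isOpen
      (isIrreducible_chart σ).isPreirreducible (chart emptyCell).isOpen
      (hT.nonempty.mono (Set.subset_inter (chart_mono (emptyCell_le σ)) subset_rfl)) hσ
    exact closure_mono Set.inter_subset_right this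
  rw [irreducibleSpace_def, Set.top_eq_univ, ← hd]
  exact isIrreducible_iff_closure.mpr hT

lemma isReduced_F1 : AlgebraicGeometry.IsReduced F1 := by
  have (i : (Scheme.IsLocallyDirected.openCover diagram).I₀) :
      AlgebraicGeometry.IsReduced ((Scheme.IsLocallyDirected.openCover diagram).X i) :=
    inferInstanceAs (AlgebraicGeometry.IsReduced (Spec (.of (coordRing i))))
  exact AlgebraicGeometry.IsReduced.of_openCover (X := Limits.colimit diagram)
    (Scheme.IsLocallyDirected.openCover diagram)

instance : IsIntegral F1 := by
  have := isReduced_F1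
  have := irreducibleSpace_F1
  exact isIntegral_of_irreducibleSpace_of_isReduced _

lemma restrict_torus_injective (W : F1.Opens) : Function.Injective
    (F1.presheaf.map (homOfLE (inf_le_right : chart emptyCell ⊓ W ≤ W)).op) := by
  by_cases h : (W : Set F1).Nonempty
  · have : Nonempty ((chart emptyCell ⊓ W : F1.Opens)) := by
      have := irreducibleSpace_F1
      obtain ⟨x, hx⟩ := nonempty_preirreducible_inter (chart emptyCell).isOpen W.isOpen
        (isIrreducible_chart emptyCell).nonempty h
      exact ⟨⟨x, hx⟩⟩
    exact map_injective_of_isIntegral _ _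
  · have hW : W = ⊥ := by
      ext x
      exact ⟨fun hx => (h ⟨x, hx⟩).elim, fun hx => hx.elim⟩
    subst hW
    have : Subsingleton Γ(F1, ⊥) := inferInstance
    exact Function.injective_of_subsingleton _

end HirzebruchOne

/-! ### Sections of line bundles as Laurent polynomials -/

namespace HirzebruchOne

open SheafLifting

/-- A Laurent polynomial as a function on the torus. -/
noncomputable def torusFun : AddMonoidAlgebra ℂ (ℤ × ℤ) →+* Γ(F1, chart emptyCell) :=
  (chartFun emptyCell).comp ((RingHom.id _).codRestrict (coordRing emptyCell)
    fun _ _ _ _ h => absurd h (Finset.notMem_empty _))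

lemma torusFun_coe (f : coordRing emptyCell) : torusFun f.1 = chartFun emptyCell f := rfl

lemma torusFun_injective : Function.Injective torusFun := fun _ _ h =>
  congrArg Subtype.val ((chartFun_bijective emptyCell).1 h)

lemma torusFun_surjective : Function.Surjective torusFun := fun x => by
  obtain ⟨f, rfl⟩ := (chartFun_bijective emptyCell).2 x
  exact ⟨f.1, rfl⟩

lemma torusFun_smul (c : ℂ) (f) :
    torusFun (c • f) = ModuleSheaf.resTop (const c) (chart emptyCell) * torusFun f := by
  rw [resTop_const, ← torusFun_coe, ← map_mul, Algebra.smul_def]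
  rfl

lemma torusMonomial_eq (m : ℤ × ℤ) : torusMonomial m = torusFun (monomial m) := rfl

lemma map_chartFun_torus (σ : Cell) (f : coordRing σ) :
    F1.presheaf.map (homOfLE (chart_mono (emptyCell_le σ))).op (chartFun σ f) = torusFun f.1 :=
  (map_chartFun (emptyCell_le σ) f).trans rfl

/-- The support of `f` avoids the poles that are forbidden for sections of the line bundle of the
divisor `D` along the curves numbered by `P`. -/
def PolesBounded (D : Fin 4 → ℤ) (P : Finset (Fin 4)) (f : AddMonoidAlgebra ℂ (ℤ × ℤ)) : Prop :=
  ∀ m, f.coeff m ≠ 0 → ∀ ρ ∈ P, -D ρ ≤ ord ρ m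

lemma mul_monomial_coeff (f : AddMonoidAlgebra ℂ (ℤ × ℤ)) (m n : ℤ × ℤ) :
    (f * monomial m).coeff n = f.coeff (n - m) := by
  simp [monomial, sub_eq_add_neg]

lemma mul_monomial_mem_coordRing {D : Fin 4 → ℤ} {σ : Cell} {m : ℤ × ℤ}
    (hm : ∀ ρ ∈ σ.1, ord ρ m = D ρ) (f : AddMonoidAlgebra ℂ (ℤ × ℤ)) :
    f * monomial m ∈ coordRing σ ↔ PolesBounded D σ.1 f := by
  constructor
  · intro h n hn ρ hρ
    have := h (n + m) (by rwa [mul_monomial_coeff, add_sub_cancel_right]) ρ hρ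
    rw [map_add, hm ρ hρ] at this
    omega
  · intro h n hn ρ hρ
    rw [mul_monomial_coeff] at hn
    have := h _ hn ρ hρ
    rw [map_sub, hm ρ hρ] at this
    omega

/-- The section `s` of `L` over the torus corresponds to the rational function `1` under an
isomorphism of `L` with the line bundle of the divisor `D`. -/
def IsRationalSection (D : Fin 4 → ℤ) (L : F1.Modules) (s : Γ(L, chart emptyCell)) : Prop :=
  ∀ σ : Cell, ∃ (e : Γ(L, chart σ)) (m : ℤ × ℤ),
    ModuleSheaf.IsFreeGenerator L (chart σ) e ∧ (∀ ρ ∈ σ.1, ord ρ m = D ρ) ∧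
      s = torusMonomial m • L.presheaf.map (homOfLE (chart_mono (emptyCell_le σ))).op e

lemma isUnit_torusMonomial (m : ℤ × ℤ) : IsUnit (torusMonomial m) := by
  refine IsUnit.of_mul_eq_one (torusMonomial (-m)) ?_
  rw [torusMonomial_eq, torusMonomial_eq, ← map_mul torusFun, monomial_mul, add_neg_cancel,
    monomial_zero, map_one]

lemma _root_.ModuleSheaf.IsFreeGenerator.map {X : Scheme.{0}} {M : X.Modules} {U V : X.Opens}
    {e : Γ(M, U)} (he : ModuleSheaf.IsFreeGenerator M U e) (h : V ≤ U) :
    ModuleSheaf.IsFreeGenerator M V (M.presheaf.map (homOfLE h).op e) := by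
  intro W hW
  have := he W (hW.trans h)
  simpa only [map_map] using this

lemma _root_.ModuleSheaf.IsFreeGenerator.isUnit_smul {X : Scheme.{0}} {M : X.Modules} {U : X.Opens}
    {e : Γ(M, U)} (he : ModuleSheaf.IsFreeGenerator M U e) {r : Γ(X, U)} (hr : IsUnit r) :
    ModuleSheaf.IsFreeGenerator M U (r • e) := by
  intro W hW
  have hu : IsUnit (X.presheaf.map (homOfLE hW).op r) := hr.map (X.presheaf.map (homOfLE hW).op).hom
  have h : (fun t : Γ(X, W) => t • M.presheaf.map (homOfLE hW).op (r • e)) =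
      (fun t : Γ(X, W) => t • M.presheaf.map (homOfLE hW).op e) ∘
        fun t => t * X.presheaf.map (homOfLE hW).op r := by
    funext t
    simp [Scheme.Modules.map_smul, mul_smul]
  rw [h]
  refine (he W hW).comp ?_
  obtain ⟨u, hu⟩ := hu
  rw [← hu]
  exact (Units.mulRight u).bijective

namespace IsRationalSection

variable {D : Fin 4 → ℤ} {L : F1.Modules} {s : Γ(L, chart emptyCell)}

lemma isFreeGenerator (hs : IsRationalSection D L s) :
    ModuleSheaf.IsFreeGenerator L (chart emptyCell) s := by
  obtain ⟨e, m, he, -, hse⟩ := hs emptyCell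
  rw [hse]
  exact (he.map _).isUnit_smul (isUnit_torusMonomial m)

/-- Sections of a line bundle are determined by their restrictions to the torus. -/
lemma restrict_injective (hs : IsRationalSection D L s) (W : F1.Opens) : Function.Injective
    (L.presheaf.map (homOfLE (inf_le_right : chart emptyCell ⊓ W ≤ W)).op) := by
  intro x y hxy
  refine eq_of_forall_nhds ((ab F1).obj L) fun p hp => ?_
  obtain ⟨σ, hσ⟩ := exists_mem_chart p
  refine ⟨W ⊓ chart σ, inf_le_left, ⟨hp, hσ⟩, ?_⟩
  obtain ⟨e, m, he, -, -⟩ := hs σ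
  obtain ⟨r, hr⟩ := (he (W ⊓ chart σ) inf_le_right).2 (L.presheaf.map (homOfLE inf_le_left).op x)
  obtain ⟨t, ht⟩ := (he (W ⊓ chart σ) inf_le_right).2 (L.presheaf.map (homOfLE inf_le_left).op y)
  dsimp only at hr ht
  have h : r = t := by
    refine restrict_torus_injective _ ((he _ (inf_le_right.trans inf_le_right)).1 ?_)
    have h1 := congrArg (L.presheaf.map (homOfLE
      (inf_le_right : chart emptyCell ⊓ (W ⊓ chart σ) ≤ _)).op) hr
    have h2 := congrArg (L.presheaf.map (homOfLE
      (inf_le_right : chart emptyCell ⊓ (W ⊓ chart σ) ≤ _)).op) ht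
    have h3 := congrArg (L.presheaf.map (homOfLE
      (inf_le_inf_left _ inf_le_left : chart emptyCell ⊓ (W ⊓ chart σ) ≤ _)).op) hxy
    rw [Scheme.Modules.map_smul, map_map, map_map] at h1 h2
    rw [map_map, map_map] at h3
    exact h1.trans (h3.trans h2.symm)
  have : L.presheaf.map (homOfLE (inf_le_left : W ⊓ chart σ ≤ W)).op x =
      L.presheaf.map (homOfLE (inf_le_left : W ⊓ chart σ ≤ W)).op y := by
    rw [← hr, ← ht, h]
  exact this

lemma restrict_injective_of_le (hs : IsRationalSection D L s) {W : F1.Opens}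
    (hW : chart emptyCell ≤ W) : Function.Injective (L.presheaf.map (homOfLE hW).op) := by
  have h := (map_bijective_of_eq L.presheaf (inf_le_left : chart emptyCell ⊓ W ≤ chart emptyCell)
    (le_inf le_rfl hW)).1
  intro x y hxy
  refine hs.restrict_injective W ?_
  have := congrArg (L.presheaf.map (homOfLE (inf_le_left : chart emptyCell ⊓ W ≤ _)).op) hxy
  rwa [map_map, map_map] at this

end IsRationalSection

/-- The sections of `L` over `V` are the `f • s` for the Laurent polynomials `f` whose poles along
the curves numbered by `P` are bounded by the divisor `D`. -/
def SectionsBounded (D : Fin 4 → ℤ) (L : F1.Modules) (s : Γ(L, chart emptyCell)) (V : F1.Opens)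
    (P : Finset (Fin 4)) : Prop :=
  ∃ hV : chart emptyCell ≤ V, ∀ f : AddMonoidAlgebra ℂ (ℤ × ℤ),
    (∃ x : Γ(L, V), L.presheaf.map (homOfLE hV).op x = torusFun f • s) ↔ PolesBounded D P f

/-- The monomials of `f` are distributed over two sets of allowed exponents. -/
lemma exists_filter (D : Fin 4 → ℤ) {P P₁ P₂ : Finset (Fin 4)}
    (hP : ∀ m, (∀ ρ ∈ P, -D ρ ≤ ord ρ m) →
      (∀ ρ ∈ P₁, -D ρ ≤ ord ρ m) ∨ (∀ ρ ∈ P₂, -D ρ ≤ ord ρ m))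
    {f : AddMonoidAlgebra ℂ (ℤ × ℤ)} (hf : PolesBounded D P f) :
    ∃ f₁ f₂, PolesBounded D P₁ f₁ ∧ PolesBounded D P₂ f₂ ∧ f = f₁ - f₂ := by
  classical
  let p : ℤ × ℤ → Prop := fun m => ∀ ρ ∈ P₁, -D ρ ≤ ord ρ m
  refine ⟨.ofCoeff (f.coeff.filter p), -.ofCoeff (f.coeff.filter fun m => ¬ p m), fun m hm => ?_,
    fun m hm => ?_, ?_⟩
  · by_contra h
    exact hm (Finsupp.filter_apply_neg _ _ h)
  · have hm' : f.coeff.filter (fun m => ¬ p m) m ≠ 0 := fun h => hm (by simp [h])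
    have h1 : ¬ p m := by
      by_contra h
      exact hm' (Finsupp.filter_apply_neg _ _ (not_not.mpr h))
    rw [Finsupp.filter_apply_pos (fun m => ¬ p m) _ h1] at hm'
    exact (hP m (hf m hm')).resolve_left h1
  · rw [sub_neg_eq_add]
    apply AddMonoidAlgebra.coeff_injective
    rw [AddMonoidAlgebra.coeff_add]
    exact (Finsupp.filter_add_filter_not f.coeff p).symm

namespace IsRationalSection

variable {D : Fin 4 → ℤ} {L : F1.Modules} {s : Γ(L, chart emptyCell)}

lemma torus_smul_bijective (hs : IsRationalSection D L s) :
    Function.Bijective fun f => torusFun f • s := by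
  have h := hs.isFreeGenerator _ le_rfl
  have h' : (fun f => torusFun f • s) =
      (fun r : Γ(F1, chart emptyCell) => r • L.presheaf.map (homOfLE le_rfl).op s) ∘ torusFun := by
    funext f
    rw [Function.comp_apply]
    congr 1
    exact (map_self L.presheaf le_rfl s).symm
  rw [h']
  exact h.comp ⟨torusFun_injective, torusFun_surjective⟩

lemma sectionsBounded_chart (hs : IsRationalSection D L s) (σ : Cell) :
    SectionsBounded D L s (chart σ) σ.1 := by
  have hσ := chart_mono (emptyCell_le σ)
  refine ⟨hσ, fun f => ?_⟩
  obtain ⟨e, m, he, hm, hse⟩ := hs σ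
  rw [← mul_monomial_mem_coordRing hm]
  have hfs : torusFun f • s = torusFun (f * monomial m) • L.presheaf.map (homOfLE hσ).op e := by
    rw [hse, smul_smul, map_mul, torusMonomial_eq]
  constructor
  · rintro ⟨x, hx⟩
    obtain ⟨r, rfl⟩ := (he (chart σ) le_rfl).2 x
    obtain ⟨g, rfl⟩ := (chartFun_bijective σ).2 r
    dsimp only at hx
    rw [Scheme.Modules.map_smul, map_map, map_chartFun_torus, hfs] at hx
    have h1 := torusFun_injective ((he _ hσ).1 hx)
    rw [← h1]
    exact g.2
  · intro h
    refine ⟨chartFun σ ⟨_, h⟩ • e, ?_⟩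
    rw [Scheme.Modules.map_smul, map_chartFun_torus, hfs]

lemma sectionsBounded_sup (hs : IsRationalSection D L s) {V₁ V₂ : F1.Opens} {P₁ P₂ : Finset (Fin 4)}
    (h₁ : SectionsBounded D L s V₁ P₁) (h₂ : SectionsBounded D L s V₂ P₂) :
    SectionsBounded D L s (V₁ ⊔ V₂) (P₁ ∪ P₂) := by
  obtain ⟨hV₁, h₁⟩ := h₁
  obtain ⟨hV₂, h₂⟩ := h₂
  refine ⟨hV₁.trans le_sup_left, fun f => ?_⟩
  have hP : PolesBounded D (P₁ ∪ P₂) f ↔ PolesBounded D P₁ f ∧ PolesBounded D P₂ f :=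
    ⟨fun h => ⟨fun m hm ρ hρ => h m hm ρ (Finset.mem_union_left _ hρ),
      fun m hm ρ hρ => h m hm ρ (Finset.mem_union_right _ hρ)⟩,
      fun h m hm ρ hρ => (Finset.mem_union.mp hρ).elim (h.1 m hm ρ) (h.2 m hm ρ)⟩
  rw [hP, ← h₁, ← h₂]
  constructor
  · rintro ⟨x, hx⟩
    exact ⟨⟨L.presheaf.map (homOfLE le_sup_left).op x, by rw [map_map, hx]⟩,
      ⟨L.presheaf.map (homOfLE le_sup_right).op x, by rw [map_map, hx]⟩⟩
  · rintro ⟨⟨x₁, hx₁⟩, ⟨x₂, hx₂⟩⟩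
    obtain ⟨x, hx, -⟩ := exists_glue ((ab F1).obj L) (V := V₁ ⊔ V₂) le_sup_left le_sup_right le_rfl
      x₁ x₂ (hs.restrict_injective_of_le (le_inf hV₁ hV₂) (by
        refine (map_map L.presheaf _ _ x₁).trans (Eq.trans ?_ (map_map L.presheaf _ _ x₂).symm)
        exact hx₁.trans hx₂.symm))
    refine ⟨x, ?_⟩
    rw [← hx₁, ← hx]
    exact (map_map L.presheaf _ _ x).symm

/-- First cohomology vanishes on `V₁ ⊔ V₂` if it does so on `V₁` and `V₂`, and each monomial section
over the overlap extends to `V₁` or to `V₂`. -/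
lemma liftsOver_sup (hs : IsRationalSection D L s) {V₁ V₂ W : F1.Opens} {P P₁ P₂ : Finset (Fin 4)}
    (h₁ : LiftsOver ((ab F1).obj L) V₁) (h₂ : LiftsOver ((ab F1).obj L) V₂)
    (hV₁ : SectionsBounded D L s V₁ P₁) (hV₂ : SectionsBounded D L s V₂ P₂)
    (hW : V₁ ⊓ V₂ = W) (hV : SectionsBounded D L s W P)
    (hP : ∀ m, (∀ ρ ∈ P, -D ρ ≤ ord ρ m) →
      (∀ ρ ∈ P₁, -D ρ ≤ ord ρ m) ∨ (∀ ρ ∈ P₂, -D ρ ≤ ord ρ m)) :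
    LiftsOver ((ab F1).obj L) (V₁ ⊔ V₂) := by
  subst hW
  obtain ⟨hV₁, hx₁⟩ := hV₁
  obtain ⟨hV₂, hx₂⟩ := hV₂
  obtain ⟨hV, hx⟩ := hV
  refine h₁.sup h₂ fun a => ?_
  obtain ⟨f, hf⟩ := hs.torus_smul_bijective.2 (L.presheaf.map (homOfLE hV).op a)
  obtain ⟨f₁, f₂, hf₁, hf₂, rfl⟩ := exists_filter D hP ((hx f).mp ⟨a, hf.symm⟩)
  obtain ⟨a₁, ha₁⟩ := (hx₁ f₁).mpr hf₁
  obtain ⟨a₂, ha₂⟩ := (hx₂ f₂).mpr hf₂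
  refine ⟨a₁, a₂, hs.restrict_injective_of_le hV ?_⟩
  refine hf.symm.trans (Eq.trans ?_ (map_sub (L.presheaf.map (homOfLE hV).op).hom
    (L.presheaf.map (homOfLE inf_le_left).op a₁)
    (L.presheaf.map (homOfLE inf_le_right).op a₂)).symm)
  refine Eq.trans ?_ (congrArg₂ (· - ·) (map_map L.presheaf inf_le_left hV a₁).symm
    (map_map L.presheaf inf_le_right hV a₂).symm)
  dsimp only
  rw [ha₁, ha₂, map_sub, sub_smul]

end IsRationalSection

end HirzebruchOne

/-! ### The covering by two open sets and multiplication maps -/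

namespace HirzebruchOne

open SheafLifting

/-- The cell given by a set of homogeneous coordinates. -/
def cell (σ : Finset (Fin 4)) (h : ¬ ({0, 1} ⊆ σ) ∧ ¬ ({2, 3} ⊆ σ)) : Cell := ⟨σ, h⟩

/-- The open subset `{t₀ ≠ 0}`, the union of two standard charts. -/
noncomputable def openT₀ : F1.Opens :=
  chart (cell {1, 2} (by decide)) ⊔ chart (cell {1, 3} (by decide))

/-- The open subset `{t₁ ≠ 0}`, the union of two standard charts. -/
noncomputable def openT₁ : F1.Opens :=
  chart (cell {0, 2} (by decide)) ⊔ chart (cell {0, 3} (by decide))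

lemma openT₀_sup_openT₁ : openT₀ ⊔ openT₁ = ⊤ := by
  refine top_le_iff.mp fun x _ => ?_
  obtain ⟨σ, hσ⟩ := exists_mem_chart x
  have key : ∀ σ : Finset (Fin 4), (¬ ({0, 1} ⊆ σ) ∧ ¬ ({2, 3} ⊆ σ)) →
      (σ ⊆ {1, 2} ∨ σ ⊆ {1, 3}) ∨ (σ ⊆ {0, 2} ∨ σ ⊆ {0, 3}) := by decide
  rcases key σ.1 σ.2 with (h | h) | (h | h)
  · exact Or.inl (Or.inl (chart_mono (τ := (cell {1, 2} (by decide))) h hσ))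
  · exact Or.inl (Or.inr (chart_mono (τ := (cell {1, 3} (by decide))) h hσ))
  · exact Or.inr (Or.inl (chart_mono (τ := (cell {0, 2} (by decide))) h hσ))
  · exact Or.inr (Or.inr (chart_mono (τ := (cell {0, 3} (by decide))) h hσ))

lemma openT₀_inf_openT₁ :
    openT₀ ⊓ openT₁ = chart (cell {2} (by decide)) ⊔ chart (cell {3} (by decide)) := by
  rw [openT₀, openT₁, inf_sup_left, inf_sup_right, inf_sup_right,
    chart_inf (ν := cell {2} (by decide)) (by decide),
    chart_inf (ν := cell ∅ (by decide)) (by decide),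
    chart_inf (ν := cell ∅ (by decide)) (by decide),
    chart_inf (ν := cell {3} (by decide)) (by decide)]
  have h2 : chart (cell ∅ (by decide)) ≤ chart (cell {2} (by decide)) := chart_mono (emptyCell_le _)
  have h3 : chart (cell ∅ (by decide)) ≤ chart (cell {3} (by decide)) := chart_mono (emptyCell_le _)
  rw [sup_eq_left.mpr h2, sup_eq_right.mpr h3]

lemma ord_apply (m : ℤ × ℤ) : ord 0 m = m.2 - m.1 ∧ ord 1 m = m.1 ∧ ord 2 m = m.2 ∧
    ord 3 m = -m.2 := ⟨rfl, rfl, rfl, rfl⟩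

namespace IsRationalSection

variable {D : Fin 4 → ℤ} {L : F1.Modules} {s : Γ(L, chart emptyCell)}

lemma sectionsBounded_openT₀ (hs : IsRationalSection D L s) :
    SectionsBounded D L s openT₀ {1, 2, 3} := by
  have h : ({1, 2, 3} : Finset (Fin 4)) = {1, 2} ∪ {1, 3} := by decide
  rw [h]
  exact hs.sectionsBounded_sup (hs.sectionsBounded_chart (cell {1, 2} (by decide)))
    (hs.sectionsBounded_chart (cell {1, 3} (by decide)))

lemma sectionsBounded_openT₁ (hs : IsRationalSection D L s) :
    SectionsBounded D L s openT₁ {0, 2, 3} := by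
  have h : ({0, 2, 3} : Finset (Fin 4)) = {0, 2} ∪ {0, 3} := by decide
  rw [h]
  exact hs.sectionsBounded_sup (hs.sectionsBounded_chart (cell {0, 2} (by decide)))
    (hs.sectionsBounded_chart (cell {0, 3} (by decide)))

lemma sectionsBounded_inf (hs : IsRationalSection D L s) :
    SectionsBounded D L s (openT₀ ⊓ openT₁) {2, 3} := by
  rw [openT₀_inf_openT₁]
  exact hs.sectionsBounded_sup (hs.sectionsBounded_chart (cell {2} (by decide)))
    (hs.sectionsBounded_chart (cell {3} (by decide)))

lemma sectionsBounded_top (hs : IsRationalSection D L s) :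
    SectionsBounded D L s ⊤ {0, 1, 2, 3} := by
  have h : ({0, 1, 2, 3} : Finset (Fin 4)) = {1, 2, 3} ∪ {0, 2, 3} := by decide
  rw [← openT₀_sup_openT₁, h]
  exact hs.sectionsBounded_sup hs.sectionsBounded_openT₀ hs.sectionsBounded_openT₁

lemma liftsOver_chart (hs : IsRationalSection D L s) (σ : Cell) :
    LiftsOver ((ab F1).obj L) (chart σ) := by
  obtain ⟨e, m, he, -, -⟩ := hs σ
  exact liftsOver_of_isAffineOpen (isAffineOpen_chart σ) he

lemma liftsOver_openT₀ (hs : IsRationalSection D L s) (hD : -1 ≤ D 2 + D 3) :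
    LiftsOver ((ab F1).obj L) openT₀ := by
  refine hs.liftsOver_sup (hs.liftsOver_chart _) (hs.liftsOver_chart _)
    (hs.sectionsBounded_chart (cell {1, 2} (by decide)))
    (hs.sectionsBounded_chart (cell {1, 3} (by decide)))
    (chart_inf (ν := (cell {1} (by decide))) (by decide)) (hs.sectionsBounded_chart _) fun m => ?_
  obtain ⟨h0, h1, h2, h3⟩ := ord_apply m
  change (∀ ρ ∈ ({1} : Finset (Fin 4)), _) → (∀ ρ ∈ ({1, 2} : Finset (Fin 4)), _) ∨
    (∀ ρ ∈ ({1, 3} : Finset (Fin 4)), _)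
  simp only [Finset.mem_insert, Finset.mem_singleton, forall_eq_or_imp, forall_eq, h1, h2, h3]
  omega

lemma liftsOver_openT₁ (hs : IsRationalSection D L s) (hD : -1 ≤ D 2 + D 3) :
    LiftsOver ((ab F1).obj L) openT₁ := by
  refine hs.liftsOver_sup (hs.liftsOver_chart _) (hs.liftsOver_chart _)
    (hs.sectionsBounded_chart (cell {0, 2} (by decide)))
    (hs.sectionsBounded_chart (cell {0, 3} (by decide)))
    (chart_inf (ν := (cell {0} (by decide))) (by decide)) (hs.sectionsBounded_chart _) fun m => ?_
  obtain ⟨h0, h1, h2, h3⟩ := ord_apply m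
  change (∀ ρ ∈ ({0} : Finset (Fin 4)), _) → (∀ ρ ∈ ({0, 2} : Finset (Fin 4)), _) ∨
    (∀ ρ ∈ ({0, 3} : Finset (Fin 4)), _)
  simp only [Finset.mem_insert, Finset.mem_singleton, forall_eq_or_imp, forall_eq, h0, h2, h3]
  omega

/-- The line bundle `𝒪(D)` has no first cohomology if no monomial on the overlap of `{t₀ ≠ 0}` and
`{t₁ ≠ 0}` has forbidden poles along both `{t₁ = 0}` and `{t₀ = 0}`; the condition `hD` is the
analogue for the coverings of these two sets by charts. -/
lemma liftsOver_top (hs : IsRationalSection D L s) (hD : -1 ≤ D 2 + D 3)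
    (hD' : D 2 ≤ D 0 + D 1 + 1) : LiftsOver ((ab F1).obj L) ⊤ := by
  rw [← openT₀_sup_openT₁]
  refine hs.liftsOver_sup (hs.liftsOver_openT₀ hD) (hs.liftsOver_openT₁ hD)
    hs.sectionsBounded_openT₀ hs.sectionsBounded_openT₁ rfl hs.sectionsBounded_inf fun m => ?_
  obtain ⟨h0, h1, h2, h3⟩ := ord_apply m
  simp only [Finset.mem_insert, Finset.mem_singleton, forall_eq_or_imp, forall_eq, h0, h1, h2, h3]
  omega

end IsRationalSection

section Multiplication

variable {D D' : Fin 4 → ℤ} {M N : F1.Modules} {s : Γ(M, chart emptyCell)}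
  {s' : Γ(N, chart emptyCell)}

lemma IsRationalSection.restrict_injective_of_inf_le (hs : IsRationalSection D M s) {W Z : F1.Opens}
    (h : Z ≤ W) (hZ : chart emptyCell ⊓ W ≤ Z) :
    Function.Injective (M.presheaf.map (homOfLE h).op) := by
  intro x y hxy
  refine hs.restrict_injective W ?_
  have := congrArg (M.presheaf.map (homOfLE hZ).op) hxy
  rwa [map_map, map_map] at this

/-- Multiplication by a Laurent polynomial `g` on the part of an open set that lies in a chart. -/
lemma exists_mul_on_chart (hs : IsRationalSection D M s) (hs' : IsRationalSection D' N s')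
    {τ : Cell} {g : AddMonoidAlgebra ℂ (ℤ × ℤ)}
    (hg : ∀ m, g.coeff m ≠ 0 → ∀ ρ ∈ τ.1, D ρ - D' ρ ≤ ord ρ m) {W : F1.Opens} (x : Γ(M, W))
    (r : Γ(F1, chart emptyCell ⊓ W)) (hx : M.presheaf.map (homOfLE inf_le_right).op x =
      r • M.presheaf.map (homOfLE inf_le_left).op s) :
    ∃ y : Γ(N, chart τ ⊓ W),
      N.presheaf.map (homOfLE (inf_le_inf_right W (chart_mono (emptyCell_le τ)))).op y =
        (r * F1.presheaf.map (homOfLE inf_le_left).op (torusFun g)) •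
          N.presheaf.map (homOfLE inf_le_left).op s' := by
  obtain ⟨e, m, he, hm, hse⟩ := hs τ
  obtain ⟨e', m', -, hm', hse'⟩ := hs' τ
  have hT := chart_mono (emptyCell_le τ)
  have hTW : chart emptyCell ⊓ W ≤ chart τ ⊓ W := inf_le_inf_right W hT
  obtain ⟨t, ht⟩ := (he (chart τ ⊓ W) inf_le_left).2 (M.presheaf.map (homOfLE inf_le_right).op x)
  have hh : g * monomial (m' - m) ∈ coordRing τ := by
    refine (mul_monomial_mem_coordRing (D := fun ρ => D' ρ - D ρ) (fun ρ hρ => ?_) g).mpr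
      fun n hn ρ hρ => ?_
    · rw [map_sub, hm ρ hρ, hm' ρ hρ]
    · have := hg n hn ρ hρ
      dsimp only
      omega
  have htr : F1.presheaf.map (homOfLE hTW).op t =
      r * F1.presheaf.map (homOfLE inf_le_left).op (torusMonomial m) := by
    refine (he _ (inf_le_left.trans hT)).1 ?_
    have h1 := congrArg (M.presheaf.map (homOfLE hTW).op) ht
    dsimp only at h1
    rw [Scheme.Modules.map_smul, map_map, map_map] at h1
    refine h1.trans (hx.trans ?_)
    rw [hse, Scheme.Modules.map_smul, map_map, smul_smul]
  refine ⟨(t * F1.presheaf.map (homOfLE inf_le_left).op (chartFun τ ⟨_, hh⟩)) •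
    N.presheaf.map (homOfLE inf_le_left).op e', ?_⟩
  have hF : F1.presheaf.map (homOfLE (inf_le_left.trans hT : chart emptyCell ⊓ W ≤ chart τ)).op
      (chartFun τ ⟨_, hh⟩) = F1.presheaf.map (homOfLE inf_le_left).op
        (torusFun g * torusFun (monomial (m' - m))) := by
    rw [← map_mul torusFun, ← map_chartFun_torus τ ⟨_, hh⟩, fun_map_map]
  have hmono : torusFun (monomial m) * torusFun (monomial (m' - m)) = torusFun (monomial m') := by
    rw [← map_mul, monomial_mul, add_sub_cancel]
  rw [Scheme.Modules.map_smul, map_map, map_mul, htr, fun_map_map, hF, hse',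
    Scheme.Modules.map_smul, map_map, smul_smul, torusMonomial_eq, torusMonomial_eq, ← hmono]
  congr 1
  simp only [map_mul]
  ring

/-- A Laurent polynomial `g` with suitably bounded poles along the curves that meet `V` defines, by
multiplication, a morphism from `M` to the direct image of the restriction of `N` to `V`. -/
lemma exists_mul_hom (hs : IsRationalSection D M s) (hs' : IsRationalSection D' N s')
    {V : F1.Opens} {τ₁ τ₂ : Cell} (hV : V = chart τ₁ ⊔ chart τ₂) {g : AddMonoidAlgebra ℂ (ℤ × ℤ)}
    (hg₁ : ∀ m, g.coeff m ≠ 0 → ∀ ρ ∈ τ₁.1, D ρ - D' ρ ≤ ord ρ m)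
    (hg₂ : ∀ m, g.coeff m ≠ 0 → ∀ ρ ∈ τ₂.1, D ρ - D' ρ ≤ ord ρ m)
    (hTV : chart emptyCell ≤ V ⊓ ⊤) :
    ∃ φ : M ⟶ (extendFrom V).obj N, ∀ (x : Γ(M, ⊤)) (f : AddMonoidAlgebra ℂ (ℤ × ℤ)),
      M.presheaf.map (homOfLE le_top).op x = torusFun f • s →
        N.presheaf.map (homOfLE hTV).op (φ.app ⊤ x) = torusFun (f * g) • s' := by
  have hT : chart emptyCell ≤ V := hTV.trans inf_le_left
  have hTW (W : F1.Opens) : chart emptyCell ⊓ W ≤ V ⊓ W := inf_le_inf_right W hT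
  -- `x = r • s` over the torus is sent to the section `y` that is `(r * g) • s'` over the torus
  let R (W : F1.Opens) (x : Γ(M, W)) (y : Γ((extendFrom V).obj N, W)) : Prop :=
    ∃ r : Γ(F1, chart emptyCell ⊓ W),
      M.presheaf.map (homOfLE inf_le_right).op x = r • M.presheaf.map (homOfLE inf_le_left).op s ∧
      N.presheaf.map (homOfLE (hTW W)).op (show Γ(N, V ⊓ W) from y) =
        (r * F1.presheaf.map (homOfLE inf_le_left).op (torusFun g)) •
          N.presheaf.map (homOfLE inf_le_left).op s'
  have hfree (W : F1.Opens) (h : W ≤ chart emptyCell) := hs.isFreeGenerator W h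
  obtain ⟨φ, hφ⟩ := exists_hom_of_relation (M := M) (N := (extendFrom V).obj N) R
    (by
      rintro W x x' y y' ⟨r, h1, h2⟩ ⟨r', h1', h2'⟩
      refine ⟨r + r', ?_, ?_⟩
      · rw [map_add, h1, h1', add_smul]
      · rw [add_mul, add_smul, ← h2, ← h2']
        exact map_add (N.presheaf.map (homOfLE (hTW W)).op).hom _ _)
    (by
      rintro W c x y ⟨r, h1, h2⟩
      refine ⟨F1.presheaf.map (homOfLE inf_le_right).op c * r, ?_, ?_⟩
      · rw [Scheme.Modules.map_smul, h1, smul_smul]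
      · rw [mul_assoc, mul_smul, ← h2]
        refine (Scheme.Modules.map_smul N (homOfLE (hTW W))
          (F1.presheaf.map (homOfLE inf_le_right).op c) (show Γ(N, V ⊓ W) from y)).trans ?_
        rw [fun_map_map])
    (by
      rintro W W' h x y ⟨r, h1, h2⟩
      have hle : chart emptyCell ⊓ W' ≤ chart emptyCell ⊓ W := inf_le_inf_left _ h
      have h1' := congrArg (M.presheaf.map (homOfLE hle).op) h1
      have h2' := congrArg (N.presheaf.map (homOfLE hle).op) h2
      rw [Scheme.Modules.map_smul, map_map, map_map] at h1' h2'
      refine ⟨F1.presheaf.map (homOfLE hle).op r, ?_, ?_⟩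
      · rw [map_map]
        exact h1'
      · refine (map_map N.presheaf _ (hTW W') (show Γ(N, V ⊓ W) from y)).trans (h2'.trans ?_)
        rw [map_mul, fun_map_map])
    (fun W x => by
      obtain ⟨r, hr⟩ := (hfree (chart emptyCell ⊓ W) inf_le_left).2
        (M.presheaf.map (homOfLE inf_le_right).op x)
      dsimp only at hr
      obtain ⟨y₁, hy₁⟩ := exists_mul_on_chart hs hs' hg₁ x r hr.symm
      obtain ⟨y₂, hy₂⟩ := exists_mul_on_chart hs hs' hg₂ x r hr.symm
      have h₁ : chart τ₁ ⊓ W ≤ V ⊓ W := inf_le_inf_right W (hV ▸ le_sup_left)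
      have h₂ : chart τ₂ ⊓ W ≤ V ⊓ W := inf_le_inf_right W (hV ▸ le_sup_right)
      have hi₁ : chart emptyCell ⊓ W ≤ chart τ₁ ⊓ W :=
        inf_le_inf_right W (chart_mono (emptyCell_le τ₁))
      have hi₂ : chart emptyCell ⊓ W ≤ chart τ₂ ⊓ W :=
        inf_le_inf_right W (chart_mono (emptyCell_le τ₂))
      obtain ⟨y, hy, -⟩ := exists_glue ((ab F1).obj N) h₁ h₂ (by rw [hV, inf_sup_right]) y₁ y₂
        (hs'.restrict_injective_of_inf_le (le_inf hi₁ hi₂)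
          (le_inf inf_le_left (inf_le_right.trans (inf_le_left.trans inf_le_right))) (by
            refine (map_map N.presheaf _ _ y₁).trans (Eq.trans ?_ (map_map N.presheaf _ _ y₂).symm)
            exact hy₁.trans hy₂.symm))
      refine ⟨y, ⟨r, hr.symm, ?_⟩, ?_⟩
      · rw [← hy₁, ← hy]
        exact (map_map N.presheaf _ _ y).symm
      · rintro y' ⟨r', h1, h2⟩
        obtain rfl : r = r' := (hfree (chart emptyCell ⊓ W) inf_le_left).1 (hr.trans h1)
        refine hs'.restrict_injective_of_inf_le (hTW W)
          (le_inf inf_le_left (inf_le_right.trans inf_le_right)) (h2.trans ?_)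
        rw [← hy₁, ← hy]
        exact (map_map N.presheaf _ _ y))
  refine ⟨φ, fun x f hx => ?_⟩
  obtain ⟨r, h1, h2⟩ := hφ ⊤ x
  have hle : chart emptyCell ⊓ ⊤ ≤ chart emptyCell := inf_le_left
  have hge : chart emptyCell ≤ chart emptyCell ⊓ ⊤ := le_inf le_rfl le_top
  have hr : r = F1.presheaf.map (homOfLE hle).op (torusFun f) := by
    refine (hfree (chart emptyCell ⊓ ⊤) inf_le_left).1 (h1.symm.trans ?_)
    have := congrArg (M.presheaf.map (homOfLE hle).op) hx
    rw [map_map, Scheme.Modules.map_smul] at this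
    exact this
  refine (map_bijective_of_eq N.presheaf hle hge).1 ?_
  refine (map_map N.presheaf hTV hle (show Γ(N, V ⊓ ⊤) from φ.app ⊤ x)).trans (h2.trans ?_)
  rw [hr, Scheme.Modules.map_smul, map_mul torusFun, map_mul]

end Multiplication

end HirzebruchOne

/-! ### Čech classes and polynomial functions -/

namespace HirzebruchOne

/-- The Laurent polynomials whose poles along the curves numbered by `P` are bounded by `D`. -/
def boundedPoles (D : Fin 4 → ℤ) (P : Finset (Fin 4)) :
    Submodule ℂ (AddMonoidAlgebra ℂ (ℤ × ℤ)) where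
  carrier := {f | PolesBounded D P f}
  zero_mem' m hm := absurd rfl hm
  add_mem' {f g} hf hg m hm := by
    by_cases h : f.coeff m = 0
    · exact hg m fun h' => hm (by
        rw [AddMonoidAlgebra.coeff_add, Finsupp.add_apply, h, h', add_zero])
    · exact hf m h
  smul_mem' c f hf m hm := hf m fun h => hm (by
    rw [AddMonoidAlgebra.coeff_smul, Finsupp.smul_apply, h, smul_zero])

lemma coeff_monomial_ne_zero {m n : ℤ × ℤ} (h : (monomial m).coeff n ≠ 0) : n = m := by
  by_contra h'
  exact h (by simp [monomial, Ne.symm h'])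

lemma monomial_mem_boundedPoles {D : Fin 4 → ℤ} {P : Finset (Fin 4)} {m : ℤ × ℤ} :
    monomial m ∈ boundedPoles D P ↔ ∀ ρ ∈ P, -D ρ ≤ ord ρ m := by
  constructor
  · intro h
    exact h m (by simp [monomial])
  · intro h n hn
    rw [coeff_monomial_ne_zero hn]
    exact h

lemma boundedPoles_le_of_monomial {D : Fin 4 → ℤ} {P : Finset (Fin 4)}
    {Q : Submodule ℂ (AddMonoidAlgebra ℂ (ℤ × ℤ))}
    (h : ∀ m : ℤ × ℤ, (∀ ρ ∈ P, -D ρ ≤ ord ρ m) → monomial m ∈ Q) : boundedPoles D P ≤ Q := by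
  intro f hf
  rw [← AddMonoidAlgebra.sum_coeff_single f]
  refine Submodule.sum_mem _ fun m hm => ?_
  have h1 : AddMonoidAlgebra.single m (f.coeff m) = f.coeff m • monomial m := by
    simp [monomial, AddMonoidAlgebra.smul_single]
  rw [h1]
  exact Q.smul_mem _ (h m (hf m (by simpa using hm)))

/-- The multiplier of the extension on which the connecting map is surjective. Multiplication by it
maps sections of `𝒪(C₀ + (k - b + 2) f)` to Čech classes of `𝒪(2 C₀ + (2 b - k - 2) f)`. -/
noncomputable def multiplier (b k : ℤ) : AddMonoidAlgebra ℂ (ℤ × ℤ) :=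
  monomial (k - b + 3, 0) + monomial (b + 1, 0) + monomial (k - 2 * b + 2, -1)

lemma coeff_multiplier_ne_zero {b k : ℤ} {m : ℤ × ℤ} (h : (multiplier b k).coeff m ≠ 0) :
    m.2 = 0 ∨ m.2 = -1 := by
  by_contra! h'
  refine h ?_
  have h1 (n : ℤ × ℤ) (hn : m ≠ n) : (monomial n).coeff m = 0 := by
    by_contra h2
    exact hn (coeff_monomial_ne_zero h2)
  rw [multiplier, AddMonoidAlgebra.coeff_add, AddMonoidAlgebra.coeff_add, Finsupp.add_apply,
    Finsupp.add_apply, h1, h1, h1, add_zero, add_zero]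
  · rintro rfl; exact h'.2 rfl
  · rintro rfl; exact h'.1 rfl
  · rintro rfl; exact h'.1 rfl

/-- Every Čech class of the line bundle of `A` is a multiple of the class of `multiplier b k`. With
`x n m = z ^ m * w ^ (-n)`, the monomials `x n m` with `m ≥ k - 2 * b + 2` or `m ≤ -n` extend to one
of the two open sets, and the multiples of the multiplier by monomials give the relations
`x n u + x n (u - (k - 2 * b + 2)) + x (n + 1) (u - b - 1) ≡ 0` for `n = 0, 1`. -/
lemma boundedPoles_inf_le {b k : ℤ} (hb : 4 ≤ b) (hk : 2 * b - 2 ≤ k) (hk' : k ≤ 4 * b - 1) :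
    boundedPoles ![0, 2 * b - k - 2, 2, 0] {2, 3} ≤
      boundedPoles ![0, 2 * b - k - 2, 2, 0] {1, 2, 3} ⊔
      boundedPoles ![0, 2 * b - k - 2, 2, 0] {0, 2, 3} ⊔
      (boundedPoles ![0, k - b + 2, 1, 0] {0, 1, 2, 3}).map
        (LinearMap.mulRight ℂ (multiplier b k)) := by
  set Q := boundedPoles ![0, 2 * b - k - 2, 2, 0] {1, 2, 3} ⊔
      boundedPoles ![0, 2 * b - k - 2, 2, 0] {0, 2, 3} ⊔
      (boundedPoles ![0, k - b + 2, 1, 0] {0, 1, 2, 3}).map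
        (LinearMap.mulRight ℂ (multiplier b k))
  let x (n m : ℤ) : AddMonoidAlgebra ℂ (ℤ × ℤ) := monomial (m, -n)
  have hx₀ (n m : ℤ) (hn : 0 ≤ n) (hn' : n ≤ 2) (hm : k - 2 * b + 2 ≤ m) : x n m ∈ Q := by
    refine Submodule.mem_sup_left (Submodule.mem_sup_left (monomial_mem_boundedPoles.mpr ?_))
    simp only [Finset.mem_insert, Finset.mem_singleton, forall_eq_or_imp, forall_eq]
    change -(2 * b - k - 2) ≤ m ∧ -2 ≤ -n ∧ -0 ≤ - -n
    omega
  have hx₁ (n m : ℤ) (hn : 0 ≤ n) (hn' : n ≤ 2) (hm : m ≤ -n) : x n m ∈ Q := by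
    refine Submodule.mem_sup_left (Submodule.mem_sup_right (monomial_mem_boundedPoles.mpr ?_))
    simp only [Finset.mem_insert, Finset.mem_singleton, forall_eq_or_imp, forall_eq]
    change -0 ≤ -n - m ∧ -2 ≤ -n ∧ -0 ≤ - -n
    omega
  have hR (n u : ℤ) (hn : 0 ≤ n) (hn' : n ≤ 1) (hu : 1 ≤ u) (hu' : u ≤ k - b + 3 - n) :
      x n u + x n (u - (k - 2 * b + 2)) + x (n + 1) (u - b - 1) ∈ Q := by
    refine Submodule.mem_sup_right ⟨x n (u - (k - b + 3)), monomial_mem_boundedPoles.mpr ?_, ?_⟩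
    · simp only [Finset.mem_insert, Finset.mem_singleton, forall_eq_or_imp, forall_eq]
      change -0 ≤ -n - (u - (k - b + 3)) ∧ -(k - b + 2) ≤ u - (k - b + 3) ∧ -1 ≤ -n ∧ -0 ≤ - -n
      omega
    · simp only [LinearMap.mulRight_apply, multiplier, x, mul_add, monomial_mul, Prod.mk_add_mk]
      refine congrArg₂ (· + ·) (congrArg₂ (· + ·) ?_ ?_) ?_ <;>
        refine congrArg monomial (Prod.ext ?_ ?_) <;> dsimp only <;> ring
  have h0 (u : ℤ) : x 0 u ∈ Q := by
    rcases le_or_gt u 0 with hu | hu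
    · exact hx₁ 0 u (by omega) (by omega) (by omega)
    rcases le_or_gt (k - 2 * b + 2) u with hu' | hu'
    · exact hx₀ 0 u (by omega) (by omega) hu'
    -- for `u = b + 1` the third term of the relation for `u` is `x 1 0`, which need not extend, but
    -- the terms of the relation for `k - b + 3` other than `x 0 (b + 1)` do
    rcases eq_or_ne u (b + 1) with rfl | hne
    · have h := hR 0 (k - b + 3) (by omega) (by omega) (by omega) (by omega)
      have e : k - b + 3 - (k - 2 * b + 2) = b + 1 := by ring
      rw [e, Q.add_mem_iff_left (hx₀ _ _ (by omega) (by omega) (by omega)),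
        Q.add_mem_iff_right (hx₀ _ _ (by omega) (by omega) (by omega))] at h
      exact h
    · have h := hR 0 u (by omega) (by omega) (by omega) (by omega)
      have h1 : x (0 + 1) (u - b - 1) ∈ Q := by
        rcases le_or_gt (u - b - 1) (-1) with hw | hw
        · exact hx₁ _ _ (by omega) (by omega) (by omega)
        · have h := hR 1 (u - b - 1) (by omega) (by omega) (by omega) (by omega)
          rw [Q.add_mem_iff_left (hx₁ _ _ (by omega) (by omega) (by omega)),
            Q.add_mem_iff_left (hx₁ _ _ (by omega) (by omega) (by omega))] at h
          exact h
      rw [Q.add_mem_iff_left h1,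
        Q.add_mem_iff_left (hx₁ _ _ (by omega) (by omega) (by omega))] at h
      exact h
  have h1 (v : ℤ) : x 1 v ∈ Q := by
    rcases le_or_gt v (-1) with hv | hv
    · exact hx₁ _ _ (by omega) (by omega) hv
    rcases le_or_gt (k - 2 * b + 2) v with hv' | hv'
    · exact hx₀ _ _ (by omega) (by omega) hv'
    have h := hR 0 (v + b + 1) (by omega) (by omega) (by omega) (by omega)
    rw [Q.add_mem_iff_right (Q.add_mem (h0 _) (h0 _))] at h
    have e : v + b + 1 - b - 1 = v := by ring
    rwa [e] at h
  have h2 (v : ℤ) : x 2 v ∈ Q := by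
    rcases le_or_gt v (-2) with hv | hv
    · exact hx₁ _ _ (by omega) (by omega) hv
    rcases le_or_gt (k - 2 * b + 2) v with hv' | hv'
    · exact hx₀ _ _ (by omega) (by omega) hv'
    have h := hR 1 (v + b + 1) (by omega) (by omega) (by omega) (by omega)
    rw [Q.add_mem_iff_right (Q.add_mem (h1 _) (h1 _))] at h
    have e : v + b + 1 - b - 1 = v := by ring
    rwa [e] at h
  refine boundedPoles_le_of_monomial fun m hm => ?_
  simp only [Finset.mem_insert, Finset.mem_singleton, forall_eq_or_imp, forall_eq] at hm
  change -2 ≤ m.2 ∧ -0 ≤ -m.2 at hm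
  have hm' : monomial m = x (-m.2) m.1 := by simp [x]
  rw [hm']
  have : -m.2 = 0 ∨ -m.2 = 1 ∨ -m.2 = 2 := by omega
  rcases this with h | h | h <;> rw [h]
  exacts [h0 _, h1 _, h2 _]

end HirzebruchOne

section Zariski

/-- The determinant of a family of endomorphisms that depends linearly on `v` is a polynomial
function of `v`. -/
lemma det_mem_polyFunctions {V W : Type*} [AddCommGroup V] [Module ℂ V] [AddCommGroup W]
    [Module ℂ W] [FiniteDimensional ℂ W] (T : V →ₗ[ℂ] W →ₗ[ℂ] W) :
    (fun v => LinearMap.det (T v)) ∈ polyFunctions V := by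
  classical
  let B := Module.finBasis ℂ W
  have h : (fun v => LinearMap.det (T v)) = ∑ σ : Equiv.Perm (Fin (Module.finrank ℂ W)),
      Equiv.Perm.sign σ • ∏ i, fun v => B.repr (T v (B i)) (σ i) := by
    funext v
    rw [← LinearMap.det_toMatrix B, Matrix.det_apply]
    simp [LinearMap.toMatrix_apply]
  rw [h]
  refine sum_mem fun σ _ => ?_
  rw [Units.smul_def]
  refine zsmul_mem (prod_mem fun i _ => ?_) _
  exact Algebra.subset_adjoin ⟨(B.coord (σ i)).comp (T.flip (B i)), rfl⟩

/-- For a bilinear map, the images of the partial maps are generically not smaller than at a given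
point. -/
lemma exists_isZariskiOpen_range_le {V S H : Type*} [AddCommGroup V] [Module ℂ V] [AddCommGroup S]
    [Module ℂ S] [AddCommGroup H] [Module ℂ H] [FiniteDimensional ℂ S] (β : V →ₗ[ℂ] S →ₗ[ℂ] H)
    (v₀ : V) : ∃ U : Set V, IsZariskiOpen U ∧ v₀ ∈ U ∧ ∀ v ∈ U,
      LinearMap.range (β v) ≤ LinearMap.range (β v₀) →
        LinearMap.range (β v₀) ≤ LinearMap.range (β v) := by
  -- with a section `ι` of `β v₀` and a projection `π` onto its image `W`, the condition is that
  -- the endomorphism `π ∘ β v ∘ ι` of `W` is invertible; at `v₀` it is the identity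
  let W := LinearMap.range (β v₀)
  obtain ⟨ι, hι⟩ := (β v₀).rangeRestrict.exists_rightInverse_of_surjective
    (β v₀).range_rangeRestrict
  obtain ⟨π, hπ⟩ := W.subtype.exists_leftInverse_of_injective W.ker_subtype
  let T : V →ₗ[ℂ] W →ₗ[ℂ] W := (β.compr₂ π).compl₂ ι
  have hT (v : V) (w : W) : T v w = π (β v (ι w)) := rfl
  have hπ' (w : W) : π w = w := LinearMap.congr_fun hπ w
  have hT₀ : T v₀ = LinearMap.id := by
    ext1 w
    have h : β v₀ (ι w) = w := congrArg Subtype.val (LinearMap.congr_fun hι w)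
    rw [hT, h, hπ', LinearMap.id_apply]
  refine ⟨{v | LinearMap.det (T v) ≠ 0}, ⟨{fun v => LinearMap.det (T v)}, ?_, ?_⟩, ?_, ?_⟩
  · exact Set.singleton_subset_iff.mpr (det_mem_polyFunctions T)
  · simp
  · simp [hT₀]
  · intro v hv hle w hw
    have hu := ((T v).isUnit_iff_isUnit_det.mpr (isUnit_iff_ne_zero.mpr hv))
    obtain ⟨w', hw'⟩ := ((Module.End.isUnit_iff _).mp hu).2 ⟨w, hw⟩
    refine ⟨ι w', ?_⟩
    have h := hπ' ⟨β v (ι w'), hle ⟨_, rfl⟩⟩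
    rw [hT] at hw'
    exact (congrArg Subtype.val h).symm.trans (congrArg Subtype.val hw')

end Zariski

/-! ### The general extension -/

namespace HirzebruchOne

open SheafLifting Abelian

lemma smul_hom_app {M N : F1.Modules} (c : ℂ) (φ : M ⟶ N) (U : F1.Opens) (x : Γ(M, U)) :
    (c • φ).app U x = ModuleSheaf.resTop (const c) U • φ.app U x :=
  Scheme.Modules.Hom.app_smul φ _ x

section Sections

variable {D : Fin 4 → ℤ} {M : F1.Modules} {s : Γ(M, chart emptyCell)}

/-- A Laurent polynomial with bounded poles gives a global section. -/
lemma IsRationalSection.exists_hom (hs : IsRationalSection D M s)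
    {f : AddMonoidAlgebra ℂ (ℤ × ℤ)} (hf : f ∈ boundedPoles D {0, 1, 2, 3}) :
    ∃ φ : structureSheaf F1 ⟶ M,
      M.presheaf.map (homOfLE le_top).op (evalOne M φ) = torusFun f • s := by
  obtain ⟨hT, h⟩ := hs.sectionsBounded_top
  obtain ⟨x, hx⟩ := (h f).mpr hf
  obtain ⟨φ, rfl⟩ := evalOne_surjective M x
  exact ⟨φ, hx⟩

lemma finiteDimensional_boundedPoles (D : Fin 4 → ℤ) :
    FiniteDimensional ℂ (boundedPoles D {0, 1, 2, 3}) := by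
  let F : Finset (ℤ × ℤ) := Finset.Icc (-D 1) (D 3 + D 0) ×ˢ Finset.Icc (-D 2) (D 3)
  have hle : boundedPoles D {0, 1, 2, 3} ≤
      Submodule.span ℂ ((F.image monomial : Finset _) : Set (AddMonoidAlgebra ℂ (ℤ × ℤ))) := by
    classical
    refine boundedPoles_le_of_monomial fun m hm => Submodule.subset_span ?_
    obtain ⟨h0, h1, h2, h3⟩ := ord_apply m
    simp only [Finset.mem_insert, Finset.mem_singleton, forall_eq_or_imp, forall_eq, h0, h1, h2,
      h3] at hm
    refine Finset.mem_coe.mpr (Finset.mem_image_of_mem _ ?_)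
    simp only [F, Finset.mem_product, Finset.mem_Icc]
    omega
  exact Submodule.finiteDimensional_of_le hle

/-- Line bundles on `𝔽₁` have finite-dimensional spaces of global sections. -/
lemma IsRationalSection.finiteDimensional_hom (hs : IsRationalSection D M s) :
    FiniteDimensional ℂ (structureSheaf F1 ⟶ M) := by
  have hex (φ : structureSheaf F1 ⟶ M) : ∃ f : boundedPoles D {0, 1, 2, 3},
      M.presheaf.map (homOfLE le_top).op (evalOne M φ) = torusFun f.1 • s := by
    obtain ⟨hT, h⟩ := hs.sectionsBounded_top
    obtain ⟨f, hf⟩ := hs.torus_smul_bijective.2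
      (M.presheaf.map (homOfLE le_top).op (evalOne M φ))
    exact ⟨⟨f, (h f).mp ⟨_, hf.symm⟩⟩, hf.symm⟩
  choose f hf using hex
  have huniq (φ) (g : boundedPoles D {0, 1, 2, 3})
      (h : M.presheaf.map (homOfLE le_top).op (evalOne M φ) = torusFun g.1 • s) : f φ = g :=
    Subtype.ext (hs.torus_smul_bijective.1 ((hf φ).symm.trans h))
  let F : (structureSheaf F1 ⟶ M) →ₗ[ℂ] boundedPoles D {0, 1, 2, 3} :=
    { toFun := f
      map_add' := fun φ ψ => huniq _ _ (by
        refine (map_add (M.presheaf.map (homOfLE le_top).op).hom (evalOne M φ)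
          (evalOne M ψ)).trans ?_
        refine (congrArg₂ (· + ·) (hf φ) (hf ψ)).trans ?_
        rw [Submodule.coe_add, map_add, add_smul])
      map_smul' := fun c φ => huniq _ _ (by
        refine (congrArg _ (smul_hom_app c φ ⊤ _)).trans ?_
        rw [Scheme.Modules.map_smul, ModuleSheaf.map_resTop]
        refine (congrArg _ (hf φ)).trans ?_
        rw [smul_smul, ← torusFun_smul]
        rfl) }
  have hF : Function.Injective F := fun φ ψ h => by
    refine evalOne_injective M (hs.restrict_injective_of_le le_top ((hf φ).trans ?_))
    have h' : f φ = f ψ := h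
    rw [h']
    exact (hf ψ).symm
  have := finiteDimensional_boundedPoles D
  exact Module.Finite.of_injective F hF

end Sections

section Extensions

variable {b k : ℤ} {A B : F1.Modules} {s : Γ(A, chart emptyCell)} {s' : Γ(B, chart emptyCell)}

lemma torus_le_inf : chart emptyCell ≤ openT₀ ⊓ openT₁ := by
  rw [openT₀_inf_openT₁]
  exact (chart_mono (emptyCell_le _)).trans le_sup_left

/-- Multiplication by `multiplier b k`, as a morphism to the direct image of `A` from the overlap of
`{t₀ ≠ 0}` and `{t₁ ≠ 0}`, produces all Čech classes of `A` from the global sections of `B`. -/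
lemma exists_surjective_hom (hb : 4 ≤ b) (hk : 2 * b - 2 ≤ k) (hk' : k ≤ 4 * b - 1)
    (hs : IsRationalSection ![0, 2 * b - k - 2, 2, 0] A s)
    (hs' : IsRationalSection ![0, k - b + 2, 1, 0] B s') :
    ∃ φ : B ⟶ (extendFrom (openT₀ ⊓ openT₁)).obj A,
      ∀ α : structureSheaf F1 ⟶ (extendFrom (openT₀ ⊓ openT₁)).obj A,
        ∃ (σ : structureSheaf F1 ⟶ B) (γ : structureSheaf F1 ⟶ (cech openT₀ openT₁ A).X₂),
          α = γ ≫ (cech openT₀ openT₁ A).g + σ ≫ φ := by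
  have hT : chart emptyCell ≤ openT₀ ⊓ openT₁ ⊓ ⊤ := le_inf torus_le_inf le_top
  have hT₀ : chart emptyCell ≤ openT₀ ⊓ ⊤ := hT.trans (inf_le_inf_right _ inf_le_left)
  have hT₁ : chart emptyCell ≤ openT₁ ⊓ ⊤ := hT.trans (inf_le_inf_right _ inf_le_right)
  obtain ⟨φ, hφ⟩ := exists_mul_hom hs' hs openT₀_inf_openT₁ (g := multiplier b k)
    (fun m hm ρ hρ => by
      obtain rfl : ρ = 2 := Finset.mem_singleton.mp hρ
      have := coeff_multiplier_ne_zero hm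
      change (1 : ℤ) - 2 ≤ m.2
      omega)
    (fun m hm ρ hρ => by
      obtain rfl : ρ = 3 := Finset.mem_singleton.mp hρ
      have := coeff_multiplier_ne_zero hm
      change (0 : ℤ) - 0 ≤ -m.2
      omega) hT
  refine ⟨φ, fun α => ?_⟩
  obtain ⟨f, hf⟩ := hs.torus_smul_bijective.2
    (A.presheaf.map (homOfLE hT).op (evalOne _ α))
  dsimp only at hf
  have hf' : f ∈ boundedPoles ![0, 2 * b - k - 2, 2, 0] {2, 3} := by
    obtain ⟨h, h'⟩ := hs.sectionsBounded_inf
    refine (h' f).mp ⟨A.presheaf.map (homOfLE (le_inf le_rfl le_top)).op (evalOne _ α), ?_⟩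
    rw [hf]
    exact map_map A.presheaf _ _ _
  obtain ⟨f₂, hf₂, p, hp, rfl⟩ := Submodule.mem_sup.mp (boundedPoles_inf_le hb hk hk' hf')
  obtain ⟨f₀, hf₀, f₁, hf₁, rfl⟩ := Submodule.mem_sup.mp hf₂
  obtain ⟨q, hq, rfl⟩ := hp
  obtain ⟨σ, hσ⟩ := hs'.exists_hom hq
  obtain ⟨h₀, h₀'⟩ := hs.sectionsBounded_openT₀
  obtain ⟨h₁, h₁'⟩ := hs.sectionsBounded_openT₁
  obtain ⟨x₀, hx₀⟩ := (h₀' f₀).mpr hf₀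
  obtain ⟨x₁, hx₁⟩ := (h₁' f₁).mpr hf₁
  obtain ⟨γ₀, hγ₀⟩ := evalOne_surjective ((extendFrom openT₀).obj A)
    (A.presheaf.map (homOfLE (inf_le_left : openT₀ ⊓ ⊤ ≤ openT₀)).op x₀)
  obtain ⟨γ₁, hγ₁⟩ := evalOne_surjective ((extendFrom openT₁).obj A)
    (A.presheaf.map (homOfLE (inf_le_left : openT₁ ⊓ ⊤ ≤ openT₁)).op x₁)
  refine ⟨σ, γ₀ ≫ cechInl openT₀ openT₁ A - γ₁ ≫ cechInr openT₀ openT₁ A, ?_⟩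
  rw [Preadditive.sub_comp, Category.assoc, Category.assoc, cechInl_g, cechInr_g,
    Preadditive.comp_neg, sub_neg_eq_add]
  refine evalOne_injective _ (hs.restrict_injective_of_le hT (hf.symm.trans ?_))
  have e₀ : A.presheaf.map (homOfLE hT).op
      (evalOne _ (γ₀ ≫ extendRes A (inf_le_left : openT₀ ⊓ openT₁ ≤ openT₀))) =
        torusFun f₀ • s := by
    refine (map_map A.presheaf (inf_le_inf_right ⊤ inf_le_left) hT (evalOne _ γ₀)).trans ?_
    rw [hγ₀, ← hx₀]
    exact map_map A.presheaf _ hT₀ x₀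
  have e₁ : A.presheaf.map (homOfLE hT).op
      (evalOne _ (γ₁ ≫ extendRes A (inf_le_right : openT₀ ⊓ openT₁ ≤ openT₁))) =
        torusFun f₁ • s := by
    refine (map_map A.presheaf (inf_le_inf_right ⊤ inf_le_right) hT (evalOne _ γ₁)).trans ?_
    rw [hγ₁, ← hx₁]
    exact map_map A.presheaf _ hT₁ x₁
  have e₂ : A.presheaf.map (homOfLE hT).op (evalOne _ (σ ≫ φ)) =
      torusFun (q * multiplier b k) • s := hφ _ _ hσ
  have hsum (u v w : structureSheaf F1 ⟶ (extendFrom (openT₀ ⊓ openT₁)).obj A) :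
      A.presheaf.map (homOfLE hT).op (evalOne _ (u + v + w)) =
        A.presheaf.map (homOfLE hT).op (evalOne _ u) +
          A.presheaf.map (homOfLE hT).op (evalOne _ v) +
            A.presheaf.map (homOfLE hT).op (evalOne _ w) := by
    refine (map_add (A.presheaf.map (homOfLE hT).op).hom (evalOne _ (u + v)) (evalOne _ w)).trans ?_
    exact congrArg (· + _)
      (map_add (A.presheaf.map (homOfLE hT).op).hom (evalOne _ u) (evalOne _ v))
  rw [hsum, e₀, e₁, e₂, map_add, map_add, add_smul, add_smul]
  rfl

/-- The products of the global sections of `B` with a class in `Ext¹(B, A)`. -/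
noncomputable def connecting (A B : F1.Modules) :
    Ext B A 1 →ₗ[ℂ] (structureSheaf F1 ⟶ B) →ₗ[ℂ] Ext (structureSheaf F1) A 1 :=
  ((Ext.bilinearCompOfLinear ℂ (structureSheaf F1) B A 0 1 1 (zero_add 1)).comp
    (Ext.linearEquiv₀ (R := ℂ)).symm.toLinearMap).flip

lemma connecting_apply (v : Ext B A 1) (σ : structureSheaf F1 ⟶ B) :
    connecting A B v σ = (Ext.mk₀ σ).comp v (zero_add 1) := rfl

/-- For the general extension of `B` by `A`, the connecting map from the global sections of `B`
reaches every Čech class of `A`. -/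
lemma exists_isZariskiOpen_subsingleton_H (hb : 4 ≤ b) (hk : 2 * b - 2 ≤ k) (hk' : k ≤ 4 * b - 1)
    (hs : IsRationalSection ![0, 2 * b - k - 2, 2, 0] A s)
    (hs' : IsRationalSection ![0, k - b + 2, 1, 0] B s') :
    ∃ U : Set (Ext B A 1), IsZariskiOpen U ∧ U.Nonempty ∧
      ∀ (E : F1.Modules) (i : A ⟶ E) (p : E ⟶ B) (w : i ≫ p = 0)
        (hS : (ShortComplex.mk i p w).ShortExact),
        hS.extClass ∈ U → Subsingleton (ModuleSheaf.H E 1) := by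
  obtain ⟨φ, hφ⟩ := exists_surjective_hom hb hk hk' hs hs'
  have hc := shortExact_cech openT₀_sup_openT₁ A
  have := hs'.finiteDimensional_hom
  let v₀ : Ext B A 1 := (Ext.mk₀ φ).comp hc.extClass (zero_add 1)
  have hv₀ (α : structureSheaf F1 ⟶ (extendFrom (openT₀ ⊓ openT₁)).obj A) :
      (Ext.mk₀ α).comp hc.extClass (zero_add 1) ∈ LinearMap.range (connecting A B v₀) := by
    obtain ⟨σ, γ, rfl⟩ := hφ α
    refine ⟨σ, ?_⟩
    have h0 : (Ext.mk₀ (γ ≫ (cech openT₀ openT₁ A).g)).comp hc.extClass (zero_add 1) = 0 := by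
      rw [← Ext.mk₀_comp_mk₀, Ext.comp_assoc_of_second_deg_zero, hc.comp_extClass, Ext.comp_zero]
    rw [Ext.mk₀_add, Ext.add_comp, h0, zero_add, connecting_apply, ← Ext.mk₀_comp_mk₀]
    exact (Ext.comp_assoc_of_second_deg_zero _ _ _ _).symm
  obtain ⟨U, hU, hv₀U, hUv⟩ := exists_isZariskiOpen_range_le (connecting A B) v₀
  refine ⟨U, hU, ⟨v₀, hv₀U⟩, fun E i p w hS hSU => ?_⟩
  have h₀ := liftsOver_top_extendFrom (hs.liftsOver_openT₀ (show (-1 : ℤ) ≤ 2 + 0 by norm_num))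
  have h₁ := liftsOver_top_extendFrom (hs.liftsOver_openT₁ (show (-1 : ℤ) ≤ 2 + 0 by norm_num))
  have h₃ := hs'.liftsOver_top (show (-1 : ℤ) ≤ 1 + 0 by norm_num) (by
    change (1 : ℤ) ≤ 0 + (k - b + 2) + 1
    omega)
  refine subsingleton_H_of_connecting_surjective openT₀_sup_openT₁ hS h₀ h₁ h₃ fun α => ?_
  have hle : LinearMap.range (connecting A B hS.extClass) ≤
      LinearMap.range (connecting A B v₀) := by
    rintro _ ⟨σ, rfl⟩
    obtain ⟨α, hα⟩ := exists_cech_representative openT₀_sup_openT₁ hS h₀ h₁ σ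
    rw [connecting_apply, ← hα]
    exact hv₀ α
  exact hUv _ hSU hle (hv₀ α)

end Extensions

end HirzebruchOne

theorem mainTheorem3 (b k : ℤ) (hb : 4 ≤ b) (hbk : b ≤ k)
    (A B : HirzebruchOne.F1.Modules)
    (hA : HirzebruchOne.IsLineBundleOfClass 2 (2 * b - k - 2) A)
    (hB : HirzebruchOne.IsLineBundleOfClass 1 (k - b + 2) B) :
    (k ≤ 2 * b - 3 →
      ∀ (E : HirzebruchOne.F1.Modules) (i : A ⟶ E) (p : E ⟶ B) (w : i ≫ p = 0),
        (ShortComplex.mk i p w).ShortExact → Subsingleton (ModuleSheaf.H E 1)) ∧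
    (2 * b - 2 ≤ k → k ≤ 4 * b - 1 →
      ∃ U : Set (Abelian.Ext B A 1), IsZariskiOpen U ∧ U.Nonempty ∧
        ∀ (E : HirzebruchOne.F1.Modules) (i : A ⟶ E) (p : E ⟶ B) (w : i ≫ p = 0)
          (hS : (ShortComplex.mk i p w).ShortExact),
          hS.extClass ∈ U → Subsingleton (ModuleSheaf.H E 1)) := by
  obtain ⟨s, hs⟩ : ∃ s, HirzebruchOne.IsRationalSection ![0, 2 * b - k - 2, 2, 0] A s := hA
  obtain ⟨s', hs'⟩ : ∃ s, HirzebruchOne.IsRationalSection ![0, k - b + 2, 1, 0] B s := hB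
  refine ⟨fun hk E i p w hS => ?_, fun hk hk' =>
    HirzebruchOne.exists_isZariskiOpen_subsingleton_H hb hk hk' hs hs'⟩
  refine SheafLifting.subsingleton_H_of_shortExact (SheafLifting.shortExact_map_ab hS)
    (hs.liftsOver_top (show (-1 : ℤ) ≤ 2 + 0 by norm_num) ?_).subsingleton_H
    (hs'.liftsOver_top (show (-1 : ℤ) ≤ 1 + 0 by norm_num) ?_).subsingleton_H
  · change (2 : ℤ) ≤ 0 + (2 * b - k - 2) + 1
    omega
  · change (1 : ℤ) ≤ 0 + (k - b + 2) + 1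
    omega
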